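/- **Theorem (case $\nabla N=0$).** Let $(\bar M,\varphi,g)$ be a Kähler manifold, i.e. a Riemannian manifold with a smooth $(1,1)$-tensor field $\varphi$ such that $\varphi^2=-I$, $g(\varphi\cdot,\varphi\cdot)=g$ and $\bar\nabla\varphi=0$, where $\bar\nabla$ is the Levi-Civita connection of $g$. Let $M$ be a submanifold of $\bar M$ defined by a (smooth) injective immersion, with the induced metric $g$ and its Levi-Civita connection $\nabla$. Define the second fundamental form $h$, the shape operators $A_V$ and the normal connection $\nabla^\perp$ by the Gauss and Weingarten formulas $\bar\nabla_XY=\nabla_XY+h(X,Y)$ and $\bar\nabla_XV=-A_VX+\nabla^\perp_XV$, for $X,Y\in\Gamma(TM)$ and $V\in\Gamma(T^\perp M)$. Write $\varphi X=TX+NX$ and $\varphi V=tV+nV$ for the decompositions into tangential and normal components. Let $k\ge 1$ and suppose that $M$ is a pointwise $k$-slant submanifold: there are mutually orthogonal smooth distributions $\mathcal D_0,\mathcal D_1,\dots,\mathcal D_k$ of constant rank on $M$ with - $TM=\mathcal D_0\oplus\mathcal D_1\oplus\dots\oplus\mathcal D_k$; - $\varphi(\mathcal D_0)\subseteq\mathcal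 D_0$ ($\mathcal D_0$ may be trivial) and $T(\mathcal D_i)\subseteq\mathcal D_i$ for $1\le i\le k$; - for $1\le i\le k$, $\mathcal D_i$ is nontrivial, and at each $p\in M$ the angle between $\varphi X_p$ and $(\mathcal D_i)_p$ has the same value $\theta_i(p)\in(0,\frac{\pi}{2}]$ for all $X_p\in(\mathcal D_i)_p\setminus\{0\}$; - $\theta_i(p)\ne\theta_j(p)$ for all $p\in M$ and all $i\ne j$ in $\{1,\dots,k\}$. Put $\theta_0=0$. Assume $\nabla N=0$, i.e. $\nabla^\perp_X(NY)-N(\nabla_XY)=0$ for all $X,Y\in\Gamma(TM)$. Then: (i) for every $i\in\{1,\dots,k\}$, $M$ is $(\mathcal D_0,\mathcal D_i)$-mixed totally geodesic: $h(X,Y)=0$ for all $X\in\Gamma(\mathcal D_0)$ and $Y\in\Gamma(\mathcal D_i)$; (ii) for every $i\in\{0,\dots,k\}$, either $h(X,Y)=0$ for all $X,Y\in\Gamma(\mathcal D_i)$; or $-\cos^2\theta_i$ is an eigenvalue function of $n^2$ (at every $p\in M$, $-\cos^2\theta_i(p)$ is an eigenvalue of $n^2$ on $T^\perp_pM$) and,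 for all $X,Y\in\Gamma(\mathcal D_i)$ and every $p\in M$ with $h(X,Y)_p\neq0$, the vector $h(X,Y)_p$ is an eigenvector of $n^2$ for the eigenvalue $-\cos^2\theta_i(p)$; (iii) for every $i\in\{0,\dots,k\}$, either $h(X,Y)=0$ for all $X\in\Gamma(\mathcal D_i)$ and $Y\in\Gamma(TM)$; or $-\cos^2\theta_i$ is an eigenvalue function of $T^2$ (at every $p\in M$, $-\cos^2\theta_i(p)$ is an eigenvalue of $T^2$ on $T_pM$) and, for all $X\in\Gamma(\mathcal D_i)$, $V\in\Gamma(T^\perp M)$ and every $p\in M$ with $(A_VX)_p\neq0$, the vector $(A_VX)_p$ is an eigenvector of $T^2$ for the eigenvalue $-\cos^2\theta_i(p)$. -/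

import Mathlib

open Bundle Manifold ContDiff VectorField Module
open scoped RealInnerProductSpace

noncomputable section

namespace SlantGeometry

set_option linter.unusedSectionVars false

/-! ### The Levi-Civita connection -/

section LeviCivita

variable {E : Type*} [NormedAddCommGroup E] [NormedSpace ℝ E] [FiniteDimensional ℝ E]
  {H : Type*} [TopologicalSpace H] (I : ModelWithCorners ℝ E H)
  {M : Type*} [TopologicalSpace M] [ChartedSpace H M]

instance finiteDimensional_tangentSpace (x : M) : FiniteDimensional ℝ (TangentSpace I x) :=
  inferInstanceAs (FiniteDimensional ℝ E)

variable [RiemannianBundle (fun x : M ↦ TangentSpace I x)]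

instance completeSpace_tangentSpace (x : M) : CompleteSpace (TangentSpace I x) :=
  FiniteDimensional.complete ℝ _

/-- The right-hand side of the Koszul formula for `2 ⟨∇_X Y, Z⟩`. -/
def koszul (X Y Z : Π x : M, TangentSpace I x) (x : M) : ℝ :=
  mvfderiv I (fun y ↦ ⟪Y y, Z y⟫) x (X x)
    + mvfderiv I (fun y ↦ ⟪X y, Z y⟫) x (Y x)
    - mvfderiv I (fun y ↦ ⟪X y, Y y⟫) x (Z x)
    + ⟪mlieBracket I X Y x, Z x⟫ - ⟪mlieBracket I X Z x, Y x⟫ - ⟪mlieBracket I Y Z x, X x⟫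

variable [IsManifold I ∞ M] [IsContMDiffRiemannianBundle I ∞ E (fun x : M ↦ TangentSpace I x)]

variable {I}

theorem mdifferentiableAt_inner {x : M} {X Y : Π x : M, TangentSpace I x}
    (hX : MDiffAt (T% X) x) (hY : MDiffAt (T% Y) x) :
    MDifferentiableAt I 𝓘(ℝ, ℝ) (fun y ↦ ⟪X y, Y y⟫) x :=
  MDifferentiableAt.inner_bundle (E := fun x : M ↦ TangentSpace I x) (b := id) hX hY

theorem koszul_tensorial_left {x : M} {Y Z : Π x : M, TangentSpace I x}
    (hY : MDiffAt (T% Y) x) (hZ : MDiffAt (T% Z) x) :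
    TensorialAt I E (fun X ↦ koszul I X Y Z x) x where
  smul {f X} hf hX := by
    simp only [koszul, Pi.smul_apply', real_inner_smul_left, mvfderiv_fun_mul hf (mdifferentiableAt_inner hX hZ),
      mvfderiv_fun_mul hf (mdifferentiableAt_inner hX hY), mlieBracket_smul_left hf hX, inner_add_left,
      real_inner_smul_right]
    simp
    ring
  add {X X'} hX hX' := by
    simp [koszul, inner_add_left, inner_add_right, mvfderiv_fun_add (mdifferentiableAt_inner hX hZ) (mdifferentiableAt_inner hX' hZ),
      mvfderiv_fun_add (mdifferentiableAt_inner hX hY) (mdifferentiableAt_inner hX' hY), mlieBracket_add_left hX hX']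
    ring

theorem koszul_tensorial_right {x : M} {X Y : Π x : M, TangentSpace I x}
    (hX : MDiffAt (T% X) x) (hY : MDiffAt (T% Y) x) :
    TensorialAt I E (fun Z ↦ koszul I X Y Z x) x where
  smul {f Z} hf hZ := by
    simp only [koszul, Pi.smul_apply', real_inner_smul_left, mvfderiv_fun_mul hf (mdifferentiableAt_inner hX hZ),
      mvfderiv_fun_mul hf (mdifferentiableAt_inner hY hZ), mlieBracket_smul_right hf hZ, inner_add_left,
      real_inner_smul_right]
    simp
    rw [real_inner_comm (Y x) (Z x), real_inner_comm (X x) (Z x)]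
    ring
  add {Z Z'} hZ hZ' := by
    simp [koszul, inner_add_left, inner_add_right, mvfderiv_fun_add (mdifferentiableAt_inner hX hZ) (mdifferentiableAt_inner hX hZ'),
      mvfderiv_fun_add (mdifferentiableAt_inner hY hZ) (mdifferentiableAt_inner hY hZ'), mlieBracket_add_right hZ hZ']
    ring

open Classical in
variable (I) in
/-- For a vector field `Y` differentiable at `x`, the bilinear form `(u, w) ↦ ⟨∇_u Y, w⟩` on the
tangent space at `x`, as given by the Koszul formula. -/
def leviCivitaForm (Y : Π x : M, TangentSpace I x) (x : M) :
    TangentSpace I x →L[ℝ] TangentSpace I x →L[ℝ] ℝ :=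
  if hY : MDiffAt (T% Y) x then
    (2⁻¹ : ℝ) • TensorialAt.mkHom₂ (fun X Z ↦ koszul I X Y Z x) x
      (fun _ hZ ↦ koszul_tensorial_left hY hZ) (fun _ hX ↦ koszul_tensorial_right hX hY)
  else 0

theorem leviCivitaForm_apply {x : M} {X Y Z : Π x : M, TangentSpace I x}
    (hX : MDiffAt (T% X) x) (hY : MDiffAt (T% Y) x) (hZ : MDiffAt (T% Z) x) :
    leviCivitaForm I Y x (X x) (Z x) = 2⁻¹ * koszul I X Y Z x := by
  rw [leviCivitaForm, dif_pos hY]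
  change 2⁻¹ * (TensorialAt.mkHom₂ (fun X Z ↦ koszul I X Y Z x) x _ _ (X x) (Z x)) = _
  rw [TensorialAt.mkHom₂_apply _ _ hX hZ]

/-- `leviCivitaFun Y x u` is the vector `∇_u Y` at `x`: the one that represents the linear form
`w ↦ leviCivitaForm I Y x u w`. -/
def leviCivitaFun (Y : Π x : M, TangentSpace I x) (x : M) :
    TangentSpace I x →L[ℝ] TangentSpace I x :=
  InnerProductSpace.continuousLinearMapOfBilin (𝕜 := ℝ) (leviCivitaForm I Y x)

theorem inner_leviCivitaFun {x : M} {X Y Z : Π x : M, TangentSpace I x}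
    (hX : MDiffAt (T% X) x) (hY : MDiffAt (T% Y) x) (hZ : MDiffAt (T% Z) x) :
    ⟪leviCivitaFun Y x (X x), Z x⟫ = 2⁻¹ * koszul I X Y Z x := by
  rw [← leviCivitaForm_apply hX hY hZ]
  exact InnerProductSpace.continuousLinearMapOfBilin_apply (𝕜 := ℝ) _ _ _

theorem ext_inner_section {x : M} {A B : TangentSpace I x →L[ℝ] TangentSpace I x}
    (h : ∀ X Z : Π x : M, TangentSpace I x, MDiffAt (T% X) x → MDiffAt (T% Z) x →
      ⟪A (X x), Z x⟫ = ⟪B (X x), Z x⟫) : A = B := by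
  ext u
  refine ext_inner_right ℝ fun w ↦ ?_
  simpa using h (FiberBundle.extend E u) (FiberBundle.extend E w)
    (FiberBundle.mdifferentiableAt_extend ..) (FiberBundle.mdifferentiableAt_extend ..)

variable (I M) in
/-- The Levi-Civita connection of the Riemannian metric of `M`. The value of `∇_X Y` at `x` is
written `leviCivita I M Y x (X x)`. -/
def leviCivita : CovariantDerivative I E (fun x : M ↦ TangentSpace I x) where
  toFun := leviCivitaFun
  isCovariantDerivativeOnUniv :=
    { add {Y Y' x} hY hY' _ := by
        refine ext_inner_section fun X Z hX hZ ↦ ?_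
        rw [inner_leviCivitaFun hX (mdifferentiableAt_add_section hY hY') hZ, add_apply, inner_add_left,
          inner_leviCivitaFun hX hY hZ, inner_leviCivitaFun hX hY' hZ]
        simp [koszul, inner_add_left, inner_add_right,
          mvfderiv_fun_add (mdifferentiableAt_inner hY hZ) (mdifferentiableAt_inner hY' hZ),
          mvfderiv_fun_add (mdifferentiableAt_inner hX hY) (mdifferentiableAt_inner hX hY'),
          mlieBracket_add_left hY hY', mlieBracket_add_right hY hY']
        ring
      leibniz {Y f x} hY hf _ := by
        refine ext_inner_section fun X Z hX hZ ↦ ?_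
        rw [inner_leviCivitaFun hX (hf.smul_section hY) hZ, add_apply, inner_add_left,
          smul_apply, real_inner_smul_left, inner_leviCivitaFun hX hY hZ]
        simp only [koszul, Pi.smul_apply', real_inner_smul_left,
          mvfderiv_fun_mul hf (mdifferentiableAt_inner hX hY),
          mvfderiv_fun_mul hf (mdifferentiableAt_inner hY hZ), mlieBracket_smul_right hf hY,
          mlieBracket_smul_left hf hY, inner_add_left, real_inner_smul_right]
        simp [real_inner_smul_left]
        rw [real_inner_comm (X x) (Y x)]
        ring }


/-- The Levi-Civita connection is metric. -/
theorem leviCivita_isMetricCompatible :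
    CovariantDerivative.IsMetricCompatible (V := fun x : M ↦ TangentSpace I x) (leviCivita I M) := by
  rw [CovariantDerivative.isMetricCompatible_iff]
  intro x X Y Z hX hY hZ
  change _ = ⟪leviCivitaFun Y x (X x), Z x⟫ + ⟪Y x, leviCivitaFun Z x (X x)⟫
  rw [real_inner_comm (leviCivitaFun Z x (X x)) (Y x), inner_leviCivitaFun hX hY hZ, inner_leviCivitaFun hX hZ hY]
  simp only [koszul]
  rw [mlieBracket_swap_apply (V := Z) (W := Y), inner_neg_left,
    show (fun y ↦ ⟪Z y, Y y⟫) = fun y ↦ ⟪Y y, Z y⟫ from funext fun y ↦ real_inner_comm _ _]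
  ring

/-- The Levi-Civita connection is torsion-free. -/
theorem leviCivita_torsion : (leviCivita I M).torsion = 0 := by
  rw [CovariantDerivative.torsion_eq_zero_iff]
  intro X Y x hX hY
  refine ext_inner_right ℝ fun w ↦ ?_
  obtain ⟨Z, hZ, rfl⟩ : ∃ Z : Π x : M, TangentSpace I x, MDiffAt (T% Z) x ∧ Z x = w :=
    ⟨FiberBundle.extend E w, FiberBundle.mdifferentiableAt_extend .., by simp⟩
  change ⟪leviCivitaFun Y x (X x) - leviCivitaFun X x (Y x), Z x⟫ = _
  rw [inner_sub_left, inner_leviCivitaFun hX hY hZ, inner_leviCivitaFun hY hX hZ]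
  simp only [koszul]
  rw [mlieBracket_swap_apply (V := Y) (W := X), inner_neg_left,
    show (fun y ↦ ⟪Y y, X y⟫) = fun y ↦ ⟪X y, Y y⟫ from funext fun y ↦ real_inner_comm _ _]
  ring

end LeviCivita

/-! ### Almost Hermitian and Kähler manifolds -/

section Kahler

variable {F : Type*} [NormedAddCommGroup F] [NormedSpace ℝ F] [FiniteDimensional ℝ F]
  {G : Type*} [TopologicalSpace G] (J : ModelWithCorners ℝ F G)
  {B : Type*} [TopologicalSpace B] [ChartedSpace G B] [IsManifold J ∞ B]
  [RiemannianBundle (fun x : B ↦ TangentSpace J x)]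

/-- A smooth vector field. -/
def IsSmoothField (X : Π x : B, TangentSpace J x) : Prop :=
  ContMDiff J J.tangent ∞ (fun x ↦ (⟨x, X x⟩ : TangentBundle J B))

/-- `φ` is a smooth (1,1)-tensor field with `φ² = -I` and `g(φ·, φ·) = g`. -/
structure IsAlmostHermitian (φ : Π x : B, TangentSpace J x →L[ℝ] TangentSpace J x) : Prop where
  contMDiff : ContMDiff J (J.prod 𝓘(ℝ, F →L[ℝ] F)) ∞
    (fun x ↦ TotalSpace.mk' (F →L[ℝ] F)
      (E := fun x : B ↦ TangentSpace J x →L[ℝ] TangentSpace J x) x (φ x))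
  map_map : ∀ (x : B) (u : TangentSpace J x), φ x (φ x u) = -u
  inner_map_map : ∀ (x : B) (u v : TangentSpace J x), ⟪φ x u, φ x v⟫ = ⟪u, v⟫

/-- An almost Hermitian structure `φ` is Kähler if `(∇_X φ) Y = ∇_X (φ Y) - φ (∇_X Y)` vanishes for
all smooth vector fields, where `∇` is the Levi-Civita connection. -/
structure IsKahler [IsContMDiffRiemannianBundle J ∞ F (fun x : B ↦ TangentSpace J x)]
    (φ : Π x : B, TangentSpace J x →L[ℝ] TangentSpace J x) : Prop
    extends IsAlmostHermitian J φ where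
  parallel : ∀ X Y : Π x : B, TangentSpace J x, IsSmoothField J X → IsSmoothField J Y →
    ∀ x : B, leviCivita J B (fun y ↦ φ y (Y y)) x (X x) - φ x (leviCivita J B Y x (X x)) = 0

end Kahler

/-! ### Submanifolds -/

section Submanifold

variable {E : Type*} [NormedAddCommGroup E] [NormedSpace ℝ E] [FiniteDimensional ℝ E]
  {H : Type*} [TopologicalSpace H] (I : ModelWithCorners ℝ E H)
  {M : Type*} [TopologicalSpace M] [ChartedSpace H M] [IsManifold I ∞ M]
  [RiemannianBundle (fun x : M ↦ TangentSpace I x)]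
  {F : Type*} [NormedAddCommGroup F] [NormedSpace ℝ F] [FiniteDimensional ℝ F]
  {G : Type*} [TopologicalSpace G] (J : ModelWithCorners ℝ F G)
  {B : Type*} [TopologicalSpace B] [ChartedSpace G B] [IsManifold J ∞ B]
  [RiemannianBundle (fun x : B ↦ TangentSpace J x)]

/-- `f` is an injective immersion, and the metric of `M` is the one induced by `f`. -/
structure IsSubmanifold (f : M → B) : Prop where
  contMDiff : ContMDiff I J ∞ f
  injective : Function.Injective f
  mfderiv_injective : ∀ p : M, Function.Injective (mfderiv I J f p)
  inner_mfderiv : ∀ (p : M) (u v : TangentSpace I p),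
    ⟪mfderiv I J f p u, mfderiv I J f p v⟫ = ⟪u, v⟫

/-- The normal space of the submanifold at `p`, a subspace of `T_{f p} B`. -/
def normalSpace (f : M → B) (p : M) : Submodule ℝ (TangentSpace J (f p)) :=
  (LinearMap.range (mfderiv I J f p).toLinearMap)ᗮ

/-- The tangential component of a vector at `f p`, as a vector tangent to `M`: since `f` is
isometric, it is the vector `u` with `⟨u, v⟩ = ⟨w, df v⟩` for all `v`. -/
def tanPart (f : M → B) (p : M) : TangentSpace J (f p) →ₗ[ℝ] TangentSpace I p :=
  LinearMap.adjoint (mfderiv I J f p).toLinearMap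

/-- The normal component of a vector at `f p`. -/
def norPart (f : M → B) (p : M) : TangentSpace J (f p) →ₗ[ℝ] normalSpace I J f p :=
  (normalSpace I J f p).orthogonalProjectionOnto.toLinearMap

/-- Every vector along the submanifold is the sum of its tangential and normal components. -/
theorem mfderiv_tanPart_add_norPart {f : M → B} (hf : IsSubmanifold I J f) (p : M)
    (w : TangentSpace J (f p)) :
    mfderiv I J f p (tanPart I J f p w) + (norPart I J f p w : TangentSpace J (f p)) = w := by
  have key : w - mfderiv I J f p (tanPart I J f p w) ∈ normalSpace I J f p := by
    rintro _ ⟨v, rfl⟩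
    have h : ⟪(mfderiv I J f p).toLinearMap v, w⟫ = ⟪v, tanPart I J f p w⟫ :=
      (LinearMap.adjoint_inner_right _ _ _).symm
    rw [inner_sub_right, h, sub_eq_zero]
    exact (hf.inner_mfderiv p _ _).symm
  have h2 : (norPart I J f p w : TangentSpace J (f p)) = w - mfderiv I J f p (tanPart I J f p w) := by
    refine (Submodule.eq_starProjection_of_mem_orthogonal key ?_)
    rw [sub_sub_cancel]
    exact Submodule.le_orthogonal_orthogonal _ ⟨_, rfl⟩
  rw [h2]
  abel

/-- The tensor `T`: the tangential component of `φ` on tangent vectors. -/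
def tensorT (f : M → B) (φ : Π x : B, TangentSpace J x →L[ℝ] TangentSpace J x) (p : M) :
    Module.End ℝ (TangentSpace I p) :=
  tanPart I J f p ∘ₗ (φ (f p)).toLinearMap ∘ₗ (mfderiv I J f p).toLinearMap

/-- The tensor `N`: the normal component of `φ` on tangent vectors. -/
def tensorN (f : M → B) (φ : Π x : B, TangentSpace J x →L[ℝ] TangentSpace J x) (p : M) :
    TangentSpace I p →ₗ[ℝ] normalSpace I J f p :=
  norPart I J f p ∘ₗ (φ (f p)).toLinearMap ∘ₗ (mfderiv I J f p).toLinearMap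

/-- The tensor `n`: the normal component of `φ` on normal vectors. -/
def tensorn (f : M → B) (φ : Π x : B, TangentSpace J x →L[ℝ] TangentSpace J x) (p : M) :
    Module.End ℝ (normalSpace I J f p) :=
  norPart I J f p ∘ₗ (φ (f p)).toLinearMap ∘ₗ (normalSpace I J f p).subtype

/-- A smooth section of the normal bundle. -/
def IsSmoothNormalField (f : M → B) (V : Π p : M, normalSpace I J f p) : Prop :=
  ContMDiff I J.tangent ∞ (fun p ↦ (⟨f p, (V p : TangentSpace J (f p))⟩ : TangentBundle J B))

/-- A smooth section of the distribution `D`. -/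
def IsSmoothSection (D : Π p : M, Submodule ℝ (TangentSpace I p))
    (X : Π p : M, TangentSpace I p) : Prop :=
  IsSmoothField I X ∧ ∀ p, X p ∈ D p

/-- A smooth regular distribution: a field of subspaces of constant rank `r` that is locally
spanned by `r` smooth vector fields. -/
def IsSmoothRegularDistribution (D : Π p : M, Submodule ℝ (TangentSpace I p)) : Prop :=
  ∃ r : ℕ, (∀ p, finrank ℝ (D p) = r) ∧
    ∀ p : M, ∃ U : Set M, IsOpen U ∧ p ∈ U ∧ ∃ X : Fin r → Π q : M, TangentSpace I q,
      (∀ j, ContMDiffOn I I.tangent ∞ (fun q ↦ (⟨q, X j q⟩ : TangentBundle I M)) U) ∧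
      ∀ q ∈ U, D q = Submodule.span ℝ (Set.range fun j ↦ X j q)

/-- The angle between a vector `v ≠ 0` and a subspace `W`, i.e. between `v` and its orthogonal
projection to `W` (`π / 2` if the projection vanishes). -/
def angleToSubspace {V : Type*} [NormedAddCommGroup V] [InnerProductSpace ℝ V]
    [FiniteDimensional ℝ V] (v : V) (W : Submodule ℝ V) : ℝ :=
  InnerProductGeometry.angle v (W.starProjection v)

/-- `f : M → B` is a pointwise `k`-slant submanifold with component distributions
`D 0, D 1, …, D k` and slant functions `θ 1, …, θ k`, where `θ 0 = 0` by convention. -/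
structure IsPointwiseSlant (f : M → B) (φ : Π x : B, TangentSpace J x →L[ℝ] TangentSpace J x)
    (k : ℕ) (D : Fin (k + 1) → Π p : M, Submodule ℝ (TangentSpace I p))
    (θ : Fin (k + 1) → M → ℝ) : Prop extends IsSubmanifold I J f where
  regular : ∀ i, IsSmoothRegularDistribution I (D i)
  orthogonal : ∀ i j, i ≠ j → ∀ p, ∀ u ∈ D i p, ∀ v ∈ D j p, ⟪u, v⟫ = 0
  iSup_eq_top : ∀ p, ⨆ i, D i p = ⊤
  tensorT_mem : ∀ i, i ≠ 0 → ∀ p, ∀ u ∈ D i p, tensorT I J f φ p u ∈ D i p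
  invariant : ∀ p, ∀ u ∈ D 0 p,
    φ (f p) (mfderiv I J f p u) ∈ (D 0 p).map (mfderiv I J f p).toLinearMap
  angle_zero : ∀ p, θ 0 p = 0
  nontrivial : ∀ i, i ≠ 0 → ∀ p, D i p ≠ ⊥
  slant : ∀ i, i ≠ 0 → ∀ p, ∀ u ∈ D i p, u ≠ 0 →
    angleToSubspace (φ (f p) (mfderiv I J f p u))
      ((D i p).map (mfderiv I J f p).toLinearMap) = θ i p
  angle_mem : ∀ i, i ≠ 0 → ∀ p, θ i p ∈ Set.Ioc 0 (Real.pi / 2)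
  angle_ne : ∀ i j, i ≠ 0 → j ≠ 0 → i ≠ j → ∀ p, θ i p ≠ θ j p

variable [IsContMDiffRiemannianBundle I ∞ E (fun x : M ↦ TangentSpace I x)]
  [IsContMDiffRiemannianBundle J ∞ F (fun x : B ↦ TangentSpace J x)]

/-- The covariant derivative along `f` of a vector field `V` along `f`, for the Levi-Civita
connection of `B` (the pullback connection on `f^* TB`): if `V = ∑ a_i (s_i ∘ f)` near `p` for a
local frame `s_i` of `TB` near `f p`, then `∇_u V = ∑ (da_i(u) s_i + a_i ∇_{df u} s_i)`. -/
def covDerivAlong (f : M → B) (V : Π p : M, TangentSpace J (f p)) (p : M) :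
    TangentSpace I p →L[ℝ] TangentSpace J (f p) :=
  let e := trivializationAt F (TangentSpace J : B → Type _) (f p)
  let b := Module.finBasis ℝ F
  ∑ i, ((mvfderiv I (fun q ↦ e.localFrameCoeff J b i (f q) (V q)) p).smulRight
          (e.localFrame b i (f p))
        + e.localFrameCoeff J b i (f p) (V p) •
          (leviCivita J B (e.localFrame b i) (f p)) ∘L mfderiv I J f p)

/-- For a vector field `Y` on `B`, the covariant derivative of `Y ∘ f` along `f` in the direction `u`
is `∇_{df u} Y`. -/
theorem covDerivAlong_comp {f : M → B} {p : M} (hf : MDifferentiableAt I J f p)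
    {Y : Π x : B, TangentSpace J x} (hY : MDiffAt (T% Y) (f p)) (u : TangentSpace I p) :
    covDerivAlong I J f (fun q ↦ Y (f q)) p u = leviCivita J B Y (f p) (mfderiv I J f p u) := by
  set e := trivializationAt F (TangentSpace J : B → Type _) (f p) with he
  have hp : f p ∈ e.baseSet := FiberBundle.mem_baseSet_trivializationAt ..
  let b := Module.finBasis ℝ F
  have hs i : MDiffAt (T% (e.localFrame b i)) (f p) :=
    (contMDiffAt_localFrame_of_mem 1 _ b i hp).mdifferentiableAt (by simp)
  have hc i : MDiffAt (LinearMap.piApply (e.localFrameCoeff J b i) Y) (f p) :=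
    mdifferentiableAt_localFrameCoeff b hp hY i
  have h1 := (leviCivita J B).isCovariantDerivativeOnUniv.congr_of_eventuallyEq hY (σ' := fun x ↦ ∑ i, e.localFrameCoeff J b i x (Y x) • e.localFrame b i x)
    (.sum_section fun i _ ↦ (hc i).smul_section (hs i)) Filter.univ_mem
    (e.eventually_eq_localFrame_sum_coeff_smul b hp)
  have h2 : ∀ s : Finset (Fin (finrank ℝ F)), leviCivita J B (fun x ↦ ∑ i ∈ s, e.localFrameCoeff J b i x (Y x) • e.localFrame b i x) (f p) =
     ∑ i ∈ s, (e.localFrameCoeff J b i (f p) (Y (f p)) • leviCivita J B (e.localFrame b i) (f p) +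
      (mvfderiv J (fun x ↦ e.localFrameCoeff J b i x (Y x)) (f p)).smulRight (e.localFrame b i (f p))) := by
    intro s
    classical
    induction s using Finset.induction_on with
    | empty =>
      simp only [Finset.sum_empty]
      exact congrFun (CovariantDerivative.zero (leviCivita J B)) (f p)
    | insert a s ha ih =>
      simp only [Finset.sum_insert ha, ← ih]
      refine Eq.trans ?_ (congrArg (· + _) ((leviCivita J B).isCovariantDerivativeOnUniv.leibniz (hs a) (hc a)))
      exact (leviCivita J B).isCovariantDerivativeOnUniv.add ((hc a).smul_section (hs a)) (.sum_section fun i _ ↦ (hc i).smul_section (hs i))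
  change (leviCivita J B) Y (f p) = _ at h1
  rw [h1, h2]
  simp only [covDerivAlong, ← he, sum_apply, add_apply]
  refine Finset.sum_congr rfl fun i _ ↦ ?_
  rw [add_comm]
  congr 1
  exact congrArg (fun c : ℝ ↦ c • e.localFrame b i (f p)) (mvfderiv_comp_apply p (hc i) hf u)

/-- The second fundamental form `h(X, Y)`, by the Gauss formula. -/
def secondFundamentalForm (f : M → B) (X Y : Π p : M, TangentSpace I p) (p : M) :
    normalSpace I J f p :=
  norPart I J f p (covDerivAlong I J f (fun q ↦ mfderiv I J f q (Y q)) p (X p))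

/-- The shape operator `A_V X`, by the Weingarten formula. -/
def shapeOperator (f : M → B) (V : Π p : M, normalSpace I J f p) (X : Π p : M, TangentSpace I p)
    (p : M) : TangentSpace I p :=
  -tanPart I J f p (covDerivAlong I J f (fun q ↦ (V q : TangentSpace J (f q))) p (X p))

/-- The normal connection `∇^⊥_X V`, by the Weingarten formula. -/
def normalConnection (f : M → B) (X : Π p : M, TangentSpace I p)
    (V : Π p : M, normalSpace I J f p) (p : M) : normalSpace I J f p :=
  norPart I J f p (covDerivAlong I J f (fun q ↦ (V q : TangentSpace J (f q))) p (X p))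

/-- `∇N = 0`: `(∇_X N) Y = ∇^⊥_X (N Y) - N (∇_X Y)` vanishes for all smooth vector fields on `M`,
where `∇` is the Levi-Civita connection of the induced metric. -/
def IsParallelN (f : M → B) (φ : Π x : B, TangentSpace J x →L[ℝ] TangentSpace J x) : Prop :=
  ∀ X Y : Π p : M, TangentSpace I p, IsSmoothField I X → IsSmoothField I Y → ∀ p : M,
    normalConnection I J f X (fun q ↦ tensorN I J f φ q (Y q)) p
      - tensorN I J f φ p (leviCivita I M Y p (X p)) = 0


end Submanifold

end SlantGeometry

end

open SlantGeometry

open Bundle Manifold ContDiff VectorField Module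
open scoped RealInnerProductSpace

noncomputable section

namespace SlantGeometry

set_option linter.unusedSectionVars false

variable {E : Type*} [NormedAddCommGroup E] [NormedSpace ℝ E] [FiniteDimensional ℝ E]
  {H : Type*} [TopologicalSpace H] {I : ModelWithCorners ℝ E H}
  {M : Type*} [TopologicalSpace M] [ChartedSpace H M]
  {F : Type*} [NormedAddCommGroup F] [NormedSpace ℝ F] [FiniteDimensional ℝ F]
  {G : Type*} [TopologicalSpace G] {J : ModelWithCorners ℝ F G}
  {B : Type*} [TopologicalSpace B] [ChartedSpace G B] [IsManifold J ∞ B]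

/-! ### Smooth vector fields with a prescribed germ -/

/-- A vector field that is smooth near `x` agrees near `x` with a smooth vector field. -/
theorem exists_isSmoothField_eventuallyEq [T2Space B] {X : Π x : B, TangentSpace J x} {u : Set B}
    {x : B} (hu : IsOpen u) (hx : x ∈ u) (hX : ContMDiffOn J J.tangent ∞ (T% X) u) :
    ∃ Y : Π x : B, TangentSpace J x, IsSmoothField J Y ∧ ∀ᶠ y in nhds x, Y y = X y := by
  obtain ⟨ψ, -, hψ⟩ := (SmoothBumpFunction.nhds_basis_tsupport (I := J) x).mem_iff.1 (hu.mem_nhds hx)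
  refine ⟨(ψ : B → ℝ) • X, ContMDiffOn.smul_section_of_tsupport ψ.contMDiff.contMDiffOn hu hψ hX, ?_⟩
  filter_upwards [ψ.eventuallyEq_one] with y hy
  simp [hy]

theorem exists_isSmoothField_apply_eq [T2Space B] {x : B} (u : TangentSpace J x) :
    ∃ X : Π x : B, TangentSpace J x, IsSmoothField J X ∧ X x = u := by
  have hx := FiberBundle.mem_baseSet_trivializationAt' (F := F) (E := (TangentSpace J : B → Type _)) x
  obtain ⟨s, hs, hX⟩ := FiberBundle.exists_contMDiffOn_extend (k := ∞) J F u
  obtain ⟨t, hts, ht, hxt⟩ := mem_nhds_iff.1 hs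
  obtain ⟨Y, hY, hYX⟩ := exists_isSmoothField_eventuallyEq ht hxt (hX.mono hts)
  exact ⟨Y, hY, by simp [hYX.self_of_nhds]⟩

theorem IsSmoothField.mdifferentiableAt {X : Π x : B, TangentSpace J x} (hX : IsSmoothField J X)
    (x : B) : MDiffAt (T% X) x :=
  ContMDiffAt.mdifferentiableAt (n := ∞) (hX x) (by simp)

theorem mvfderiv_congr {F' : Type*} [NormedAddCommGroup F'] [NormedSpace ℝ F'] {a a' : M → F'}
    {p : M} (h : ∀ᶠ q in nhds p, a q = a' q) : mvfderiv I a p = mvfderiv I a' p := by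
  ext u
  have := Filter.EventuallyEq.mfderiv_eq (I := I) (I' := 𝓘(ℝ, F')) h
  simp only [mvfderiv]
  exact congrArg (fun L : E →L[ℝ] F' ↦ L u) this

/-! ### Vector fields along a map -/

section Along

theorem localFrameCoeff_eq_repr {ι : Type*} (b : Basis ι ℝ F)
    (e : Trivialization F (TotalSpace.proj : TotalSpace F (TangentSpace J : B → Type _) → B))
    [MemTrivializationAtlas e] {x : B} (hx : x ∈ e.baseSet) (v : TangentSpace J x) (i : ι) :
    e.localFrameCoeff J b i x v = b.repr (e ⟨x, v⟩).2 i := by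
  have h := e.localFrameCoeff_eq_coeff (I := J) (b := b) (s := FiberBundle.extend F v) hx (i := i)
  simpa using h

variable (I J) in
/-- Differentiability at a point of a vector field along a map. -/
def MDifferentiableAlongAt (f : M → B) (V : Π p : M, TangentSpace J (f p)) (p : M) : Prop :=
  MDifferentiableAt I J.tangent (fun q ↦ (⟨f q, V q⟩ : TangentBundle J B)) p

variable {f : M → B} {p : M} {V W : Π p : M, TangentSpace J (f p)}

theorem eventually_mem_baseSet (hf : ContinuousAt f p) :
    ∀ᶠ q in nhds p, f q ∈ (trivializationAt F (TangentSpace J : B → Type _) (f p)).baseSet :=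
  hf.eventually ((trivializationAt F (TangentSpace J : B → Type _) (f p)).open_baseSet.mem_nhds
    (FiberBundle.mem_baseSet_trivializationAt' _))

theorem mdifferentiableAlongAt_iff (hf : MDifferentiableAt I J f p) :
    MDifferentiableAlongAt I J f V p ↔ MDifferentiableAt I 𝓘(ℝ, F)
      (fun q ↦ (trivializationAt F (TangentSpace J : B → Type _) (f p)).continuousLinearMapAt ℝ
        (f q) (V q)) p := by
  rw [MDifferentiableAlongAt, mdifferentiableAt_totalSpace, and_iff_right hf]
  refine Filter.EventuallyEq.mdifferentiableAt_iff ?_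
  filter_upwards [eventually_mem_baseSet (J := J) hf.continuousAt] with q hq
  exact (Trivialization.continuousLinearMapAt_apply_of_mem ℝ _ hq _).symm

theorem MDifferentiableAlongAt.add (hf : MDifferentiableAt I J f p)
    (hV : MDifferentiableAlongAt I J f V p) (hW : MDifferentiableAlongAt I J f W p) :
    MDifferentiableAlongAt I J f (fun q ↦ V q + W q) p := by
  rw [mdifferentiableAlongAt_iff hf] at *
  simp only [map_add]
  exact hV.add hW

theorem MDifferentiableAlongAt.sub (hf : MDifferentiableAt I J f p)
    (hV : MDifferentiableAlongAt I J f V p) (hW : MDifferentiableAlongAt I J f W p) :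
    MDifferentiableAlongAt I J f (fun q ↦ V q - W q) p := by
  rw [mdifferentiableAlongAt_iff hf] at *
  simp only [map_sub]
  exact hV.sub hW

theorem MDifferentiableAlongAt.smul (hf : MDifferentiableAt I J f p) {a : M → ℝ}
    (ha : MDifferentiableAt I 𝓘(ℝ, ℝ) a p) (hV : MDifferentiableAlongAt I J f V p) :
    MDifferentiableAlongAt I J f (fun q ↦ a q • V q) p := by
  rw [mdifferentiableAlongAt_iff hf] at *
  simp only [map_smul]
  exact ha.smul hV

theorem MDifferentiableAlongAt.zero (hf : MDifferentiableAt I J f p) :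
    MDifferentiableAlongAt I J f (fun _ ↦ 0) p := by
  rw [mdifferentiableAlongAt_iff hf]
  simpa only [map_zero] using mdifferentiableAt_const

theorem MDifferentiableAlongAt.comp (hf : MDifferentiableAt I J f p)
    {Y : Π x : B, TangentSpace J x} (hY : MDiffAt (T% Y) (f p)) :
    MDifferentiableAlongAt I J f (fun q ↦ Y (f q)) p :=
  MDifferentiableAt.comp p hY hf

theorem MDifferentiableAlongAt.mdifferentiableAt_coeff (hV : MDifferentiableAlongAt I J f V p)
    (hf : MDifferentiableAt I J f p) {ι : Type*} [Finite ι] (b : Basis ι ℝ F) (i : ι) :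
    MDifferentiableAt I 𝓘(ℝ, ℝ) (fun q ↦ (trivializationAt F (TangentSpace J : B → Type _)
      (f p)).localFrameCoeff J b i (f q) (V q)) p := by
  have h2 : MDifferentiableAt 𝓘(ℝ, F) 𝓘(ℝ, ℝ) (LinearMap.toContinuousLinearMap (b.coord i))
      ((trivializationAt F (TangentSpace J : B → Type _) (f p)).continuousLinearMapAt ℝ
        (f p) (V p)) :=
    (ContinuousLinearMap.differentiableAt _).mdifferentiableAt
  refine (h2.comp p ((mdifferentiableAlongAt_iff hf).1 hV)).congr_of_eventuallyEq ?_
  filter_upwards [eventually_mem_baseSet (J := J) hf.continuousAt] with q hq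
  rw [localFrameCoeff_eq_repr b _ hq]
  simp only [Function.comp_apply, LinearMap.coe_toContinuousLinearMap', Basis.coord_apply]
  rw [Trivialization.continuousLinearMapAt_apply_of_mem ℝ _ hq]

/-- Every vector field along a map is, locally, a combination of restrictions of smooth fields. -/
theorem MDifferentiableAlongAt.induction [T2Space B] (hf : MDifferentiableAt I J f p)
    {P : (Π p : M, TangentSpace J (f p)) → Prop}
    (congr : ∀ V W, (∀ᶠ q in nhds p, W q = V q) → P V → P W)
    (zero : P fun _ ↦ 0)
    (add : ∀ V W, MDifferentiableAlongAt I J f V p → MDifferentiableAlongAt I J f W p →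
      P V → P W → P fun q ↦ V q + W q)
    (smul : ∀ (a : M → ℝ) (Y : Π x : B, TangentSpace J x), MDifferentiableAt I 𝓘(ℝ, ℝ) a p →
      IsSmoothField J Y → P fun q ↦ a q • Y (f q))
    (hV : MDifferentiableAlongAt I J f V p) : P V := by
  classical
  set e := trivializationAt F (TangentSpace J : B → Type _) (f p) with he
  have hp : f p ∈ e.baseSet := FiberBundle.mem_baseSet_trivializationAt' _
  let b := Module.finBasis ℝ F
  have hs i : ∃ Y : Π x : B, TangentSpace J x, IsSmoothField J Y ∧
      ∀ᶠ y in nhds (f p), Y y = e.localFrame b i y :=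
    exists_isSmoothField_eventuallyEq e.open_baseSet hp (e.contMDiffOn_localFrame_baseSet ∞ b i)
  choose Y hY hYe using hs
  let a i q := e.localFrameCoeff J b i (f q) (V q)
  have ha i : MDifferentiableAt I 𝓘(ℝ, ℝ) (a i) p := hV.mdifferentiableAt_coeff hf b i
  have key : ∀ s : Finset (Fin (finrank ℝ F)),
      MDifferentiableAlongAt I J f (fun q ↦ ∑ i ∈ s, a i q • Y i (f q)) p ∧
        P fun q ↦ ∑ i ∈ s, a i q • Y i (f q) := by
    intro s
    induction s using Finset.induction_on with
    | empty => simpa using ⟨MDifferentiableAlongAt.zero hf, zero⟩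
    | insert i s hi ih =>
      simp only [Finset.sum_insert hi]
      have h := MDifferentiableAlongAt.smul hf (ha i)
        (MDifferentiableAlongAt.comp hf ((hY i).mdifferentiableAt _))
      exact ⟨h.add hf ih.1, add _ _ h ih.1 (smul _ _ (ha i) (hY i)) ih.2⟩
  refine congr _ _ ?_ (key Finset.univ).2
  filter_upwards [eventually_mem_baseSet (J := J) hf.continuousAt,
    Filter.eventually_all.2 fun i ↦ hf.continuousAt.eventually (hYe i)] with q hq hYq
  simp only [hYq, a]
  have := e.eq_sum_localFrameCoeff_smul (I := J) (b := b) (s := FiberBundle.extend F (V q)) hq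
  simpa using this

variable [RiemannianBundle (fun x : B ↦ TangentSpace J x)]
  [IsContMDiffRiemannianBundle J ∞ F (fun x : B ↦ TangentSpace J x)]

theorem covDerivAlong_congr (h : ∀ᶠ q in nhds p, V q = W q) :
    covDerivAlong I J f V p = covDerivAlong I J f W p := by
  simp only [covDerivAlong]
  refine Finset.sum_congr rfl fun i _ ↦ ?_
  rw [h.self_of_nhds, mvfderiv_congr (h.mono fun q hq ↦ congrArg _ hq)]

theorem covDerivAlong_zero : covDerivAlong I J f (fun _ ↦ 0) p = 0 := by
  have : mvfderiv I (fun _ : M ↦ (0 : ℝ)) p = 0 := mvfderiv_const 0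
  simp only [covDerivAlong, map_zero, this, zero_smul, add_zero]
  refine Finset.sum_eq_zero fun i _ ↦ ?_
  ext u
  simp

theorem covDerivAlong_add (hf : MDifferentiableAt I J f p)
    (hV : MDifferentiableAlongAt I J f V p) (hW : MDifferentiableAlongAt I J f W p) :
    covDerivAlong I J f (fun q ↦ V q + W q) p
      = covDerivAlong I J f V p + covDerivAlong I J f W p := by
  simp only [covDerivAlong, ← Finset.sum_add_distrib, map_add]
  refine Finset.sum_congr rfl fun i _ ↦ ?_
  rw [mvfderiv_fun_add (hV.mdifferentiableAt_coeff hf _ i) (hW.mdifferentiableAt_coeff hf _ i)]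
  ext u
  simp
  module

theorem covDerivAlong_smul (hf : MDifferentiableAt I J f p) {a : M → ℝ}
    (ha : MDifferentiableAt I 𝓘(ℝ, ℝ) a p) (hV : MDifferentiableAlongAt I J f V p)
    (u : TangentSpace I p) :
    covDerivAlong I J f (fun q ↦ a q • V q) p u
      = mvfderiv I a p u • V p + a p • covDerivAlong I J f V p u := by
  have hp : f p ∈ (trivializationAt F (TangentSpace J : B → Type _) (f p)).baseSet :=
    FiberBundle.mem_baseSet_trivializationAt' _
  have h0 := (trivializationAt F (TangentSpace J : B → Type _) (f p)).eq_sum_localFrameCoeff_smul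
    (I := J) (b := Module.finBasis ℝ F) (s := FiberBundle.extend F (V p)) hp
  simp only [FiberBundle.extend_apply_self] at h0
  conv_rhs => enter [1]; rw [h0]
  simp only [covDerivAlong, sum_apply, Finset.smul_sum, ← Finset.sum_add_distrib, map_smul]
  refine Finset.sum_congr rfl fun i _ ↦ ?_
  simp only [smul_eq_mul]
  rw [mvfderiv_fun_mul ha (hV.mdifferentiableAt_coeff hf _ i)]
  simp
  module

end Along
section Parallel

variable [IsManifold I ∞ M] [RiemannianBundle (fun x : M ↦ TangentSpace I x)]
  [IsContMDiffRiemannianBundle I ∞ E (fun x : M ↦ TangentSpace I x)]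
  [T2Space B] [RiemannianBundle (fun x : B ↦ TangentSpace J x)]
  [IsContMDiffRiemannianBundle J ∞ F (fun x : B ↦ TangentSpace J x)]
  {f : M → B} {p : M} {V W : Π p : M, TangentSpace J (f p)}

theorem IsAlmostHermitian.mdifferentiableAlongAt
    {φ : Π x : B, TangentSpace J x →L[ℝ] TangentSpace J x} (hφ : IsAlmostHermitian J φ)
    (hf : MDifferentiableAt I J f p) (hV : MDifferentiableAlongAt I J f V p) :
    MDifferentiableAlongAt I J f (fun q ↦ φ (f q) (V q)) p := by
  have h := (hφ.contMDiff.mdifferentiableAt (x := f p) (by simp)).comp p hf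
  exact MDifferentiableAt.clm_bundle_apply (F₁ := F) (F₂ := F) (b := f) h hV

/-- On a Kähler manifold, `φ` commutes with the covariant derivative along a map. -/
theorem IsKahler.covDerivAlong_map
    {φ : Π x : B, TangentSpace J x →L[ℝ] TangentSpace J x} (hφ : IsKahler J φ)
    (hf : MDifferentiableAt I J f p) (hV : MDifferentiableAlongAt I J f V p)
    (u : TangentSpace I p) :
    covDerivAlong I J f (fun q ↦ φ (f q) (V q)) p u
      = φ (f p) (covDerivAlong I J f V p u) := by
  refine MDifferentiableAlongAt.induction (V := V) hf
    (P := fun V ↦ covDerivAlong I J f (fun q ↦ φ (f q) (V q)) p u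
      = φ (f p) (covDerivAlong I J f V p u)) ?_ ?_ ?_ ?_ hV
  · intro V W h hV
    rw [covDerivAlong_congr h, ← hV, covDerivAlong_congr]
    filter_upwards [h] with q hq
    rw [hq]
  · simp [covDerivAlong_zero]
  · intro V W hV hW hV' hW'
    simp only [map_add]
    rw [covDerivAlong_add hf (hφ.mdifferentiableAlongAt hf hV) (hφ.mdifferentiableAlongAt hf hW),
      covDerivAlong_add hf hV hW, add_apply, add_apply, map_add, hV', hW']
  · intro a Y ha hY
    have hY' : MDiffAt (T% fun x ↦ φ x (Y x)) (f p) :=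
      hφ.mdifferentiableAlongAt (f := id) mdifferentiableAt_id (hY.mdifferentiableAt (f p))
    obtain ⟨X, hX, hXu⟩ := exists_isSmoothField_apply_eq (mfderiv I J f p u)
    have h := hφ.parallel X Y hX hY (f p)
    rw [hXu, sub_eq_zero] at h
    simp only [map_smul]
    rw [covDerivAlong_smul hf ha (.comp hf hY'),
      covDerivAlong_smul hf ha (.comp hf (hY.mdifferentiableAt _)), covDerivAlong_comp I J hf hY',
      covDerivAlong_comp I J hf (hY.mdifferentiableAt _), map_add, map_smul, map_smul, h]

theorem MDifferentiableAlongAt.inner (hV : MDifferentiableAlongAt I J f V p)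
    (hW : MDifferentiableAlongAt I J f W p) :
    MDifferentiableAt I 𝓘(ℝ, ℝ) (fun q ↦ ⟪V q, W q⟫) p :=
  MDifferentiableAt.inner_bundle (E := fun x : B ↦ TangentSpace J x) (b := f) hV hW

theorem mvfderiv_inner_comp (hf : MDifferentiableAt I J f p) {Y Z : Π x : B, TangentSpace J x}
    (hY : IsSmoothField J Y) (hZ : IsSmoothField J Z) (u : TangentSpace I p) :
    mvfderiv I (fun q ↦ ⟪Y (f q), Z (f q)⟫) p u
      = ⟪covDerivAlong I J f (fun q ↦ Y (f q)) p u, Z (f p)⟫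
        + ⟪Y (f p), covDerivAlong I J f (fun q ↦ Z (f q)) p u⟫ := by
  have hY' := hY.mdifferentiableAt (f p)
  have hZ' := hZ.mdifferentiableAt (f p)
  obtain ⟨X, hX, hXu⟩ := exists_isSmoothField_apply_eq (mfderiv I J f p u)
  have h := (leviCivita_isMetricCompatible (I := J) (M := B)).mvfderiv_inner_eq
    (V := fun x : B ↦ TangentSpace J x) X hY' hZ'
  have hc := mvfderiv_comp_apply p (mdifferentiableAt_inner hY' hZ') hf u
  simp only [hXu] at h
  rw [covDerivAlong_comp I J hf hY', covDerivAlong_comp I J hf hZ']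
  exact hc.trans h

theorem mvfderiv_inner_along_comp (hf : MDifferentiableAt I J f p) {Y : Π x : B, TangentSpace J x}
    (hY : IsSmoothField J Y) (hW : MDifferentiableAlongAt I J f W p) (u : TangentSpace I p) :
    mvfderiv I (fun q ↦ ⟪Y (f q), W q⟫) p u
      = ⟪covDerivAlong I J f (fun q ↦ Y (f q)) p u, W p⟫
        + ⟪Y (f p), covDerivAlong I J f W p u⟫ := by
  have hYf := MDifferentiableAlongAt.comp hf (hY.mdifferentiableAt (f p))
  refine MDifferentiableAlongAt.induction (V := W) hf
    (P := fun W ↦ mvfderiv I (fun q ↦ ⟪Y (f q), W q⟫) p u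
      = ⟪covDerivAlong I J f (fun q ↦ Y (f q)) p u, W p⟫
        + ⟪Y (f p), covDerivAlong I J f W p u⟫) ?_ ?_ ?_ ?_ hW
  · intro V V' h hV
    rw [covDerivAlong_congr h, h.self_of_nhds, ← hV, mvfderiv_congr]
    filter_upwards [h] with q hq
    rw [hq]
  · have : mvfderiv I (fun _ : M ↦ (0 : ℝ)) p = 0 := mvfderiv_const 0
    simp [covDerivAlong_zero, this]
  · intro V V' hV hV' h h'
    simp only [inner_add_right]
    rw [covDerivAlong_add hf hV hV', mvfderiv_fun_add (hYf.inner hV) (hYf.inner hV'), add_apply,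
      add_apply, inner_add_right, h, h']
    ring
  · intro a Z ha hZ
    have hZf := MDifferentiableAlongAt.comp hf (hZ.mdifferentiableAt (f p))
    simp only [real_inner_smul_right]
    rw [covDerivAlong_smul hf ha hZf, mvfderiv_fun_mul ha (hYf.inner hZf)]
    simp only [add_apply, smul_apply, inner_add_right, real_inner_smul_right, smul_eq_mul,
      mvfderiv_inner_comp hf hY hZ]
    ring

/-- The covariant derivative along a map is metric. -/
theorem mvfderiv_inner_along (hf : MDifferentiableAt I J f p)
    (hV : MDifferentiableAlongAt I J f V p) (hW : MDifferentiableAlongAt I J f W p)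
    (u : TangentSpace I p) :
    mvfderiv I (fun q ↦ ⟪V q, W q⟫) p u
      = ⟪covDerivAlong I J f V p u, W p⟫ + ⟪V p, covDerivAlong I J f W p u⟫ := by
  refine MDifferentiableAlongAt.induction (V := V) hf
    (P := fun V ↦ mvfderiv I (fun q ↦ ⟪V q, W q⟫) p u
      = ⟪covDerivAlong I J f V p u, W p⟫ + ⟪V p, covDerivAlong I J f W p u⟫) ?_ ?_ ?_ ?_ hV
  · intro V V' h hV
    rw [covDerivAlong_congr h, h.self_of_nhds, ← hV, mvfderiv_congr]
    filter_upwards [h] with q hq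
    rw [hq]
  · have : mvfderiv I (fun _ : M ↦ (0 : ℝ)) p = 0 := mvfderiv_const 0
    simp [covDerivAlong_zero, this]
  · intro V V' hV hV' h h'
    simp only [inner_add_left]
    rw [covDerivAlong_add hf hV hV', mvfderiv_fun_add (hV.inner hW) (hV'.inner hW), add_apply,
      add_apply, inner_add_left, h, h']
    ring
  · intro a Y ha hY
    have hYf := MDifferentiableAlongAt.comp hf (hY.mdifferentiableAt (f p))
    simp only [real_inner_smul_left]
    rw [covDerivAlong_smul hf ha hYf, mvfderiv_fun_mul ha (hYf.inner hW)]
    simp only [add_apply, smul_apply, mvfderiv_inner_along_comp hf hY hW, inner_add_left,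
      real_inner_smul_left, smul_eq_mul]
    ring

end Parallel
section Torsion

theorem localCoord_self (x : B) (v : TangentSpace J x) :
    (trivializationAt F (TangentSpace J : B → Type _) x).continuousLinearMapAt ℝ x v = v := by
  rw [TangentBundle.continuousLinearMapAt_trivializationAt_eq_core (mem_chart_source G x)]
  exact (tangentBundleCore J B).coordChange_self _ _ (mem_achart_source G x) _

theorem symmL_self (x : B) (v : F) :
    (trivializationAt F (TangentSpace J : B → Type _) x).symmL ℝ x v = v := by
  rw [TangentBundle.symmL_trivializationAt_eq_core (mem_chart_source G x)]
  exact (tangentBundleCore J B).coordChange_self _ _ (mem_achart_source G x) _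

theorem extend_eq_symmL {x y : B} (v : TangentSpace J x)
    (hy : y ∈ (trivializationAt F (TangentSpace J : B → Type _) x).baseSet) :
    FiberBundle.extend F v y
      = (trivializationAt F (TangentSpace J : B → Type _) x).symmL ℝ y (v : F) := by
  have h : (trivializationAt F (TangentSpace J : B → Type _) x ⟨x, v⟩).2 = (v : F) := by
    have := localCoord_self (J := J) x v
    rwa [Trivialization.continuousLinearMapAt_apply_of_mem ℝ _
      (FiberBundle.mem_baseSet_trivializationAt' x)] at this
  simp only [FiberBundle.extend, h]
  exact (Trivialization.symmL_apply _ hy _).symm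

theorem mpullbackWithin_extend (x : B) (v : TangentSpace J x) :
    ∀ᶠ y in nhdsWithin (extChartAt J x x) (Set.range J),
      mpullbackWithin 𝓘(ℝ, F) J (extChartAt J x).symm (FiberBundle.extend F v) (Set.range J) y
        = (v : F) := by
  filter_upwards [extChartAt_target_mem_nhdsWithin x] with y hy
  have hx : (extChartAt J x).symm y ∈ (chartAt G x).source := by
    rw [← extChartAt_source J]
    exact (extChartAt J x).map_target hy
  have h := TangentBundle.symmL_trivializationAt (I := J) hx
  rw [(extChartAt J x).right_inv hy] at h
  rw [mpullbackWithin_apply, extend_eq_symmL v (by simpa using hx), h]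
  exact (isInvertible_mfderivWithin_extChartAt_symm hy).inverse_apply_eq.2 rfl

theorem lieBracketWithin_const (v w : F) (s : Set F) (x : F) :
    lieBracketWithin ℝ (fun _ ↦ v) (fun _ ↦ w) s x = 0 := by
  simp [lieBracketWithin]

theorem mlieBracket_extend (x : B) (v w : TangentSpace J x) :
    mlieBracket J (FiberBundle.extend F v) (FiberBundle.extend F w) x = 0 := by
  have hx : extChartAt J x x ∈ Set.range J := by simp [extChartAt]
  have h : lieBracketWithin ℝ
      (mpullbackWithin 𝓘(ℝ, F) J (extChartAt J x).symm (FiberBundle.extend F v) (Set.range J))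
      (mpullbackWithin 𝓘(ℝ, F) J (extChartAt J x).symm (FiberBundle.extend F w) (Set.range J))
      (Set.range J) (extChartAt J x x) = 0 := by
    rw [Filter.EventuallyEq.lieBracketWithin_vectorField_eq_of_mem
      (E := F) (V := fun _ ↦ v) (W := fun _ ↦ w) (mpullbackWithin_extend x v)
      (mpullbackWithin_extend x w) hx]
    exact lieBracketWithin_const _ _ _ _
  rw [mlieBracket, mlieBracketWithin_apply]
  simp only [Set.preimage_univ, Set.univ_inter]
  rw [h]
  exact map_zero (mfderiv J 𝓘(ℝ, F) (extChartAt J x) x).inverse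

variable [IsManifold I ∞ M] [RiemannianBundle (fun x : M ↦ TangentSpace I x)]
  [IsContMDiffRiemannianBundle I ∞ E (fun x : M ↦ TangentSpace I x)]
  [RiemannianBundle (fun x : B ↦ TangentSpace J x)]
  [IsContMDiffRiemannianBundle J ∞ F (fun x : B ↦ TangentSpace J x)]
  {f : M → B} {p : M} {V : Π p : M, TangentSpace J (f p)}

variable (J) in
/-- The coordinates near `p` of a vector field along a map, in the chart at `f p`. -/
def coordAlong (f : M → B) (p : M) (V : Π p : M, TangentSpace J (f p)) (q : M) : F :=
  (trivializationAt F (TangentSpace J : B → Type _) (f p)).continuousLinearMapAt ℝ (f q) (V q)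

variable (I J) in
/-- The derivative at `p` of the coordinates of a vector field along `f`, in the chart at `f p`. -/
def coordDerivAlong (f : M → B) (p : M) (V : Π p : M, TangentSpace J (f p)) :
    TangentSpace I p →L[ℝ] TangentSpace J (f p) :=
  mvfderiv I (coordAlong J f p V) p

theorem mvfderiv_clm_comp {F' : Type*} [NormedAddCommGroup F'] [NormedSpace ℝ F'] {c : M → F}
    (hc : MDifferentiableAt I 𝓘(ℝ, F) c p) (L : F →L[ℝ] F') (u : TangentSpace I p) :
    mvfderiv I (fun q ↦ L (c q)) p u = L (mvfderiv I c p u) := by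
  have h : MDifferentiableAt 𝓘(ℝ, F) 𝓘(ℝ, F') L (c p) := L.differentiableAt.mdifferentiableAt
  have h1 := mfderiv_comp_apply p h hc u
  have h2 : mfderiv 𝓘(ℝ, F) 𝓘(ℝ, F') L (c p) = L := by rw [mfderiv_eq_fderiv, L.fderiv]
  rw [h2] at h1
  exact h1

/-- The covariant derivative along a map in the chart at `f p`. -/
theorem covDerivAlong_eq_coordAlong (hf : MDifferentiableAt I J f p)
    (hV : MDifferentiableAlongAt I J f V p) (u : TangentSpace I p) :
    covDerivAlong I J f V p u
      = coordDerivAlong I J f p V u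
        + leviCivita J B (FiberBundle.extend F (V p)) (f p) (mfderiv I J f p u) := by
  set e := trivializationAt F (TangentSpace J : B → Type _) (f p) with he
  have hp : f p ∈ e.baseSet := FiberBundle.mem_baseSet_trivializationAt' _
  let b := Module.finBasis ℝ F
  have hev := eventually_mem_baseSet (J := J) hf.continuousAt
  have hcoeff (i) : mvfderiv I (fun q ↦ e.localFrameCoeff J b i (f q) (V q)) p u
      = b.coord i (mvfderiv I (coordAlong J f p V) p u) := by
    have h := mvfderiv_clm_comp ((mdifferentiableAlongAt_iff hf).1 hV)
      (LinearMap.toContinuousLinearMap (b.coord i)) u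
    refine Eq.trans ?_ h
    rw [mvfderiv_congr]
    filter_upwards [hev] with q hq
    rw [localFrameCoeff_eq_repr b e hq, LinearMap.coe_toContinuousLinearMap', Basis.coord_apply,
      Trivialization.continuousLinearMapAt_apply_of_mem ℝ _ hq]
  have hconst (i) : mvfderiv I
      (fun q ↦ e.localFrameCoeff J b i (f q) (FiberBundle.extend F (V p) (f q))) p = 0 := by
    rw [mvfderiv_congr (a' := fun _ ↦ b.repr (e ⟨f p, V p⟩).2 i)]
    · exact mvfderiv_const _
    · filter_upwards [hev] with q hq
      rw [localFrameCoeff_eq_repr b e hq]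
      simp only [FiberBundle.extend, ← he]
      rw [e.apply_mk_symm hq]
  rw [← covDerivAlong_comp I J hf (FiberBundle.mdifferentiableAt_extend ..)]
  simp only [covDerivAlong, ← he, sum_apply, add_apply, FiberBundle.extend_apply_self]
  rw [Finset.sum_add_distrib, Finset.sum_add_distrib]
  have h0 : ∑ i, (ContinuousLinearMap.smulRight (mvfderiv I
      (fun q ↦ e.localFrameCoeff J b i (f q) (FiberBundle.extend F (V p) (f q))) p)
      (e.localFrame b i (f p))) u = 0 := by
    refine Finset.sum_eq_zero fun i _ ↦ ?_
    rw [hconst i]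
    simp
  have h1 : ∑ i, (ContinuousLinearMap.smulRight (mvfderiv I
      (fun q ↦ e.localFrameCoeff J b i (f q) (V q)) p) (e.localFrame b i (f p))) u
      = e.symmL ℝ (f p) (mvfderiv I (coordAlong J f p V) p u) := by
    conv_rhs => rw [← b.sum_repr (mvfderiv I (coordAlong J f p V) p u), map_sum]
    refine Finset.sum_congr rfl fun i _ ↦ ?_
    rw [ContinuousLinearMap.smulRight_apply, hcoeff i, map_smul,
      e.localFrame_apply_of_mem_baseSet b hp]
    simp [Trivialization.basisAt, e.symmL_apply hp]
  exact congrArg₂ (· + ·) (h1.trans (symmL_self (f p) _)) ((zero_add _).symm.trans (congrArg (· + _) h0.symm))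

end Torsion
section Symmetry

variable [IsManifold I ∞ M] {p : M}

theorem mvfderiv_clm_apply {F' : Type*} [NormedAddCommGroup F'] [NormedSpace ℝ F']
    {A : M → F →L[ℝ] F'} {c : M → F} (hA : MDifferentiableAt I 𝓘(ℝ, F →L[ℝ] F') A p)
    (hc : MDifferentiableAt I 𝓘(ℝ, F) c p) (u : TangentSpace I p) :
    mvfderiv I (fun q ↦ A q (c q)) p u
      = mvfderiv I A p u (c p) + A p (mvfderiv I c p u) := by
  have h := (isBoundedBilinearMap_apply (𝕜 := ℝ) (E := F) (F := F')).hasFDerivAt (A p, c p)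
  have h' : HasMFDerivAt 𝓘(ℝ, (F →L[ℝ] F') × F) 𝓘(ℝ, F') (fun x : (F →L[ℝ] F') × F ↦ x.1 x.2)
      (A p, c p) _ := h.hasMFDerivAt
  have h2 := (h'.comp p (HasMFDerivAt.prodMk hA.hasMFDerivAt hc.hasMFDerivAt)).mfderiv
  have h3 := congrArg (fun L : E →L[ℝ] F' ↦ L u) h2
  refine h3.trans (add_comm _ _)

/-- The derivative of a function in the chart at `p`. -/
theorem eventually_mvfderiv_eq [I.Boundaryless] {g : M → F} (hg : ContMDiffAt I 𝓘(ℝ, F) ∞ g p) :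
    ∀ᶠ q in nhds p, ∀ v : TangentSpace I q, mvfderiv I g q v
      = fderiv ℝ (g ∘ (extChartAt I p).symm) (extChartAt I p q)
        ((trivializationAt E (TangentSpace I : M → Type _) p).continuousLinearMapAt ℝ q v) := by
  have hĝ : ContDiffAt ℝ 1 (g ∘ (extChartAt I p).symm) (extChartAt I p p) := by
    have h := (contMDiffAt_iff.1 hg).2
    rw [I.range_eq_univ, contDiffWithinAt_univ] at h
    exact h.of_le ENat.LEInfty.out
  have hd := (continuousAt_extChartAt (I := I) p).eventually (hĝ.eventually (by simp))
  filter_upwards [hd, (chartAt H p).open_source.mem_nhds (mem_chart_source H p)] with q hq hqs v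
  have hev : (g ∘ (extChartAt I p).symm) ∘ extChartAt I p =ᶠ[nhds q] g := by
    filter_upwards [(chartAt H p).open_source.mem_nhds hqs] with y hy
    have hy' : y ∈ (extChartAt I p).source := by rwa [extChartAt_source]
    simp only [Function.comp_apply]
    rw [(extChartAt I p).left_inv hy']
  have h := mfderiv_comp_apply q (hq.differentiableAt (by simp)).mdifferentiableAt
    (mdifferentiableAt_extChartAt (I := I) hqs) v
  rw [TangentBundle.continuousLinearMapAt_trivializationAt hqs]
  rw [mfderiv_eq_fderiv] at h
  exact (congrArg (fun L : E →L[ℝ] F ↦ L v) (mvfderiv_congr (I := I) hev)).symm.trans h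

variable (I) in
/-- The derivative at `p` of the coordinates of a vector field, in the chart at `p`. -/
def coordDeriv (p : M) (X : Π q : M, TangentSpace I q) : TangentSpace I p →L[ℝ] TangentSpace I p :=
  coordDerivAlong I I id p X

/-- `X (Y g) - Y (X g)` is the derivative of `g` along the bracket of `X` and `Y`. -/
theorem mvfderiv_comm [I.Boundaryless] {g : M → F} (hg : ContMDiffAt I 𝓘(ℝ, F) ∞ g p)
    {X Y : Π q : M, TangentSpace I q} (hX : MDiffAt (T% X) p) (hY : MDiffAt (T% Y) p) :
    mvfderiv I (fun q ↦ mvfderiv I g q (Y q)) p (X p)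
      - mvfderiv I (fun q ↦ mvfderiv I g q (X q)) p (Y p)
      = mvfderiv I g p (coordDeriv I p Y (X p) - coordDeriv I p X (Y p)) := by
  set ĝ := g ∘ (extChartAt I p).symm with hĝ
  set A : M → E →L[ℝ] F := fun q ↦ fderiv ℝ ĝ (extChartAt I p q)
  have hĝ' : ContDiffAt ℝ ∞ ĝ (extChartAt I p p) := by
    have h := (contMDiffAt_iff.1 hg).2
    rw [I.range_eq_univ, contDiffWithinAt_univ] at h
    exact h
  have h2 : ContDiffAt ℝ 1 (fderiv ℝ ĝ) (extChartAt I p p) := hĝ'.fderiv_right (m := 1) (by simpa [one_add_one_eq_two] using ENat.LEInfty.out)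
  have hψ : MDifferentiableAt I 𝓘(ℝ, E) (extChartAt I p) p :=
    mdifferentiableAt_extChartAt (mem_chart_source H p)
  have hψ' : mfderiv I 𝓘(ℝ, E) (extChartAt I p) p = ContinuousLinearMap.id ℝ E := by
    rw [← TangentBundle.continuousLinearMapAt_trivializationAt (mem_chart_source H p)]
    ext v
    exact localCoord_self p v
  have h3 : MDifferentiableAt 𝓘(ℝ, E) 𝓘(ℝ, E →L[ℝ] F) (fderiv ℝ ĝ) (extChartAt I p p) :=
    (h2.differentiableAt (by simp)).mdifferentiableAt
  have hA : MDifferentiableAt I 𝓘(ℝ, E →L[ℝ] F) A p := h3.comp p hψ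
  have hA' (u : TangentSpace I p) :
      mvfderiv I A p u = fderiv ℝ (fderiv ℝ ĝ) (extChartAt I p p) u := by
    have h := mfderiv_comp_apply p h3 hψ u
    rw [hψ', mfderiv_eq_fderiv] at h
    exact h
  have key (Z : Π q : M, TangentSpace I q) (hZ : MDiffAt (T% Z) p) (u : TangentSpace I p) :
      mvfderiv I (fun q ↦ mvfderiv I g q (Z q)) p u
        = fderiv ℝ (fderiv ℝ ĝ) (extChartAt I p p) u (Z p)
          + mvfderiv I g p (coordDeriv I p Z u) := by
    have hη := (mdifferentiableAlongAt_iff (f := id) mdifferentiableAt_id).1 hZ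
    have hev := eventually_mvfderiv_eq hg
    have h := mvfderiv_clm_apply hA hη u
    have h1 := congrArg (fun L : E →L[ℝ] F ↦ L u)
      (mvfderiv_congr (I := I) (hev.mono fun q hq ↦ hq (Z q)))
    have h2 := (hev.self_of_nhds (coordDeriv I p Z u)).trans
      (congrArg (A p) (localCoord_self p _))
    refine h1.trans (h.trans (congrArg₂ (· + ·) ?_ h2.symm))
    rw [hA']
    exact congrArg (fun v : E ↦ fderiv ℝ (fderiv ℝ ĝ) (extChartAt I p p) u v)
      (localCoord_self p (Z p))
  have hs : fderiv ℝ (fderiv ℝ ĝ) (extChartAt I p p) (X p) (Y p)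
      = fderiv ℝ (fderiv ℝ ĝ) (extChartAt I p p) (Y p) (X p) :=
    (hĝ'.isSymmSndFDerivAt (by simpa using ENat.LEInfty.out)).eq _ _
  rw [map_sub, key Y hY, key X hX]
  exact (congrArg (· + _ - _) hs).trans (add_sub_add_left_eq_sub _ _ _)

end Symmetry

section Gauss

variable [IsManifold I ∞ M] [RiemannianBundle (fun x : M ↦ TangentSpace I x)]
  [IsContMDiffRiemannianBundle I ∞ E (fun x : M ↦ TangentSpace I x)]
  [RiemannianBundle (fun x : B ↦ TangentSpace J x)]
  [IsContMDiffRiemannianBundle J ∞ F (fun x : B ↦ TangentSpace J x)]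
  {f : M → B} {p : M}

theorem leviCivita_extend_comm (x : B) (v w : TangentSpace J x) :
    leviCivita J B (FiberBundle.extend F v) x w = leviCivita J B (FiberBundle.extend F w) x v := by
  have h := (CovariantDerivative.torsion_eq_zero_iff _).1 (leviCivita_torsion (I := J) (M := B))
    (FiberBundle.mdifferentiableAt_extend J F w) (FiberBundle.mdifferentiableAt_extend J F v)
  rw [mlieBracket_extend, sub_eq_zero] at h
  simpa using h

theorem leviCivita_sub_leviCivita {X Y : Π q : M, TangentSpace I q} (hX : MDiffAt (T% X) p)
    (hY : MDiffAt (T% Y) p) :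
    leviCivita I M Y p (X p) - leviCivita I M X p (Y p)
      = coordDeriv I p Y (X p) - coordDeriv I p X (Y p) := by
  have key (Z : Π q : M, TangentSpace I q) (hZ : MDiffAt (T% Z) p) (u : TangentSpace I p) :
      leviCivita I M Z p u = coordDeriv I p Z u
        + leviCivita I M (FiberBundle.extend E (Z p)) p u := by
    have h := covDerivAlong_comp I I (f := id) (p := p) mdifferentiableAt_id hZ u
    have h' := covDerivAlong_eq_coordAlong (f := id) (p := p) (V := Z) mdifferentiableAt_id hZ u
    rw [mfderiv_id] at h h'
    exact h.symm.trans h'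
  rw [key Y hY, key X hX, leviCivita_extend_comm p (Y p) (X p)]
  exact add_sub_add_right_eq_sub _ _ _

theorem ContMDiff.along_mfderiv (hf : ContMDiff I J ∞ f) {Y : Π q : M, TangentSpace I q}
    (hY : IsSmoothField I Y) :
    ContMDiff I J.tangent ∞ (fun q ↦ (⟨f q, mfderiv I J f q (Y q)⟩ : TangentBundle J B)) :=
  (hf.contMDiff_tangentMap (m := ∞) (by simp)).comp hY

/-- The pullback of the Levi-Civita connection is torsion-free. -/
theorem covDerivAlong_mfderiv_sub [I.Boundaryless] (hf : ContMDiff I J ∞ f)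
    {X Y : Π q : M, TangentSpace I q} (hX : IsSmoothField I X) (hY : IsSmoothField I Y) (p : M) :
    covDerivAlong I J f (fun q ↦ mfderiv I J f q (Y q)) p (X p)
      - covDerivAlong I J f (fun q ↦ mfderiv I J f q (X q)) p (Y p)
      = mfderiv I J f p (leviCivita I M Y p (X p) - leviCivita I M X p (Y p)) := by
  have hfp : MDifferentiableAt I J f p := (hf p).mdifferentiableAt (by simp)
  set g : M → F := extChartAt J (f p) ∘ f
  have hg : ContMDiffAt I 𝓘(ℝ, F) ∞ g p := (contMDiffAt_extChartAt (x := f p)).comp p (hf p)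
  have hc (Z : Π q : M, TangentSpace I q) : ∀ᶠ q in nhds p,
      coordAlong J f p (fun q ↦ mfderiv I J f q (Z q)) q = mvfderiv I g q (Z q) := by
    filter_upwards [hf.continuous.continuousAt.eventually
      ((chartAt G (f p)).open_source.mem_nhds (mem_chart_source G (f p)))] with q hq
    rw [coordAlong, TangentBundle.continuousLinearMapAt_trivializationAt hq]
    exact (mfderiv_comp_apply q (mdifferentiableAt_extChartAt hq)
      ((hf q).mdifferentiableAt (by simp)) (Z q)).symm
  have hg' (u : TangentSpace I p) : (mfderiv I J f p u : F) = mvfderiv I g p u := by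
    have h := mfderiv_comp_apply p (mdifferentiableAt_extChartAt (I := J) (mem_chart_source G (f p)))
      hfp u
    rw [← TangentBundle.continuousLinearMapAt_trivializationAt (mem_chart_source G (f p))] at h
    have h' := localCoord_self (J := J) (f p) (mfderiv I J f p u)
    exact (h.trans h').symm
  have key (Z : Π q : M, TangentSpace I q) (hZ : IsSmoothField I Z) (u : TangentSpace I p) :=
    covDerivAlong_eq_coordAlong (V := fun q ↦ mfderiv I J f q (Z q)) hfp
      ((ContMDiff.along_mfderiv hf hZ p).mdifferentiableAt (by simp)) u
  have hcoord (Z : Π q : M, TangentSpace I q) (u : TangentSpace I p) :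
      coordDerivAlong I J f p (fun q ↦ mfderiv I J f q (Z q)) u
        = mvfderiv I (fun q ↦ mvfderiv I g q (Z q)) p u :=
    congrArg (fun L : E →L[ℝ] F ↦ L u) (mvfderiv_congr (I := I) (hc Z))
  rw [key Y hY, key X hX, leviCivita_extend_comm (f p) (mfderiv I J f p (Y p)),
    leviCivita_sub_leviCivita (hX.mdifferentiableAt p) (hY.mdifferentiableAt p),
    add_sub_add_right_eq_sub]
  refine (congrArg₂ (· - ·) (hcoord Y _) (hcoord X _)).trans ?_
  exact (mvfderiv_comm hg (hX.mdifferentiableAt p) (hY.mdifferentiableAt p)).trans (hg' _).symm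

end Gauss
section Decomposition

variable [IsManifold I ∞ M] [RiemannianBundle (fun x : M ↦ TangentSpace I x)]
  [RiemannianBundle (fun x : B ↦ TangentSpace J x)] {f : M → B} {p : M}

theorem inner_tanPart (w : TangentSpace J (f p)) (v : TangentSpace I p) :
    ⟪tanPart I J f p w, v⟫ = ⟪w, mfderiv I J f p v⟫ :=
  LinearMap.adjoint_inner_left _ _ _

theorem inner_mfderiv_normal (u : TangentSpace I p) (V : normalSpace I J f p) :
    ⟪mfderiv I J f p u, (V : TangentSpace J (f p))⟫ = 0 :=
  V.2 _ ⟨u, rfl⟩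

theorem IsSubmanifold.tanPart_mfderiv (hf : IsSubmanifold I J f) (u : TangentSpace I p) :
    tanPart I J f p (mfderiv I J f p u) = u := by
  refine ext_inner_right ℝ fun v ↦ ?_
  rw [inner_tanPart, hf.inner_mfderiv]

theorem norPart_normal (V : normalSpace I J f p) : norPart I J f p V = V :=
  Submodule.orthogonalProjectionOnto_mem_subspace_eq_self V

theorem norPart_mfderiv (u : TangentSpace I p) : norPart I J f p (mfderiv I J f p u) = 0 := by
  refine Submodule.orthogonalProjectionOnto_eq_zero_iff.2 ?_
  exact Submodule.le_orthogonal_orthogonal _ ⟨u, rfl⟩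

theorem inner_norPart (w : TangentSpace J (f p)) (V : normalSpace I J f p) :
    ⟪norPart I J f p w, V⟫ = ⟪w, (V : TangentSpace J (f p))⟫ :=
  Submodule.inner_orthogonalProjectionOnto_eq_of_mem_right _ _

variable {φ : Π x : B, TangentSpace J x →L[ℝ] TangentSpace J x}

theorem IsSubmanifold.map_mfderiv (hf : IsSubmanifold I J f) (u : TangentSpace I p) :
    φ (f p) (mfderiv I J f p u) = mfderiv I J f p (tensorT I J f φ p u)
      + (tensorN I J f φ p u : TangentSpace J (f p)) :=
  (mfderiv_tanPart_add_norPart I J hf p _).symm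

theorem IsSubmanifold.norPart_map (hf : IsSubmanifold I J f) (w : TangentSpace J (f p)) :
    norPart I J f p (φ (f p) w) = tensorN I J f φ p (tanPart I J f p w)
      + tensorn I J f φ p (norPart I J f p w) := by
  conv_lhs => rw [← mfderiv_tanPart_add_norPart I J hf p w, map_add, map_add]
  rfl

theorem IsAlmostHermitian.inner_map_left (hφ : IsAlmostHermitian J φ) {x : B}
    (u v : TangentSpace J x) : ⟪φ x u, v⟫ = -⟪u, φ x v⟫ := by
  rw [← hφ.inner_map_map x u, hφ.map_map, inner_neg_right, neg_neg]

theorem tensorT_apply (u : TangentSpace I p) :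
    tensorT I J f φ p u = tanPart I J f p (φ (f p) (mfderiv I J f p u)) :=
  rfl

theorem tensorN_apply (u : TangentSpace I p) :
    tensorN I J f φ p u = norPart I J f p (φ (f p) (mfderiv I J f p u)) :=
  rfl

theorem tensorn_apply (V : normalSpace I J f p) :
    tensorn I J f φ p V = norPart I J f p (φ (f p) V) :=
  rfl

theorem inner_tensorT_left (hφ : IsAlmostHermitian J φ) (u v : TangentSpace I p) :
    ⟪tensorT I J f φ p u, v⟫ = -⟪u, tensorT I J f φ p v⟫ := by
  rw [tensorT_apply, inner_tanPart, hφ.inner_map_left, tensorT_apply, real_inner_comm _ u,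
    inner_tanPart, real_inner_comm]

theorem inner_tensorn_left (hφ : IsAlmostHermitian J φ) (V W : normalSpace I J f p) :
    ⟪tensorn I J f φ p V, W⟫ = -⟪V, tensorn I J f φ p W⟫ := by
  rw [tensorn_apply, inner_norPart, hφ.inner_map_left, tensorn_apply, real_inner_comm _ V,
    inner_norPart, real_inner_comm]

end Decomposition

section Smooth

theorem ContMDiffAt.matrix_det {ι : Type*} [Fintype ι] [DecidableEq ι] {A : M → Matrix ι ι ℝ}
    {p : M} (hA : ∀ i j, ContMDiffAt I 𝓘(ℝ, ℝ) ∞ (fun q ↦ A q i j) p) :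
    ContMDiffAt I 𝓘(ℝ, ℝ) ∞ (fun q ↦ (A q).det) p := by
  simp only [Matrix.det_apply']
  refine contMDiffAt_finsetSum fun σ _ ↦ contMDiffAt_const.mul ?_
  exact contMDiffAt_finsetProd fun i _ ↦ hA _ _

variable [IsManifold I ∞ M] [T2Space M] [RiemannianBundle (fun x : M ↦ TangentSpace I x)]
  [IsContMDiffRiemannianBundle I ∞ E (fun x : M ↦ TangentSpace I x)]

/-- A vector field whose inner products with smooth vector fields are smooth is smooth. -/
theorem isSmoothField_of_inner {W : Π q : M, TangentSpace I q}
    (hW : ∀ Z, IsSmoothField I Z → ContMDiff I 𝓘(ℝ, ℝ) ∞ fun q ↦ ⟪W q, Z q⟫) :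
    IsSmoothField I W := by
  intro p
  classical
  set e := trivializationAt E (TangentSpace I : M → Type _) p with he
  have hp : p ∈ e.baseSet := FiberBundle.mem_baseSet_trivializationAt' _
  let b := Module.finBasis ℝ E
  have hs i : ∃ Y : Π x : M, TangentSpace I x, IsSmoothField I Y ∧
      ∀ᶠ y in nhds p, Y y = e.localFrame b i y :=
    exists_isSmoothField_eventuallyEq e.open_baseSet hp (e.contMDiffOn_localFrame_baseSet ∞ b i)
  choose Z hZ hZe using hs
  let A : M → Matrix (Fin (finrank ℝ E)) (Fin (finrank ℝ E)) ℝ := fun q ↦ Matrix.gram ℝ fun i ↦ Z i q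
  let l : M → Fin (finrank ℝ E) → ℝ := fun q i ↦ ⟪W q, Z i q⟫
  have hA i j : ContMDiffAt I 𝓘(ℝ, ℝ) ∞ (fun q ↦ A q i j) p :=
    ContMDiffAt.inner_bundle (E := fun x : M ↦ TangentSpace I x) (b := id) (hZ i p) (hZ j p)
  have hl i : ContMDiffAt I 𝓘(ℝ, ℝ) ∞ (fun q ↦ l q i) p := hW _ (hZ i) p
  have hev : ∀ᶠ q in nhds p, (A q).det ≠ 0 ∧
      W q = ∑ i, (((A q).det)⁻¹ * (A q).cramer (l q) i) • Z i q := by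
    filter_upwards [e.open_baseSet.mem_nhds hp, Filter.eventually_all.2 hZe] with q hq hZq
    have hli : LinearIndependent ℝ fun i ↦ Z i q := by
      have h := (e.basisAt b hq).linearIndependent
      have hb : (fun i ↦ Z i q) = e.basisAt b hq := by
        ext1 i
        rw [hZq, e.localFrame_apply_of_mem_baseSet b hq]
      rw [hb]
      exact h
    have hdet : (A q).det ≠ 0 := (Matrix.posDef_gram_of_linearIndependent hli).det_pos.ne'
    refine ⟨hdet, ?_⟩
    have hWq : W q = ∑ i, e.localFrameCoeff I b i q (W q) • Z i q := by
      simp only [hZq]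
      exact e.eq_sum_localFrameCoeff_smul hq
    have hlq : l q = (A q).mulVec fun i ↦ e.localFrameCoeff I b i q (W q) := by
      ext i
      simp only [l]
      conv_lhs => rw [hWq]
      simp only [Matrix.mulVec, dotProduct, A, Matrix.gram, Matrix.of_apply, sum_inner,
        real_inner_smul_left]
      refine Finset.sum_congr rfl fun j _ ↦ ?_
      rw [mul_comm, real_inner_comm]
    have hc : (A q).cramer (l q) = (A q).det • fun i ↦ e.localFrameCoeff I b i q (W q) := by
      rw [hlq, Matrix.cramer_eq_adjugate_mulVec, Matrix.mulVec_mulVec, Matrix.adjugate_mul,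
        Matrix.smul_mulVec, Matrix.one_mulVec]
    rw [hc]
    conv_lhs => rw [hWq]
    refine Finset.sum_congr rfl fun i _ ↦ ?_
    rw [Pi.smul_apply, smul_eq_mul, inv_mul_cancel_left₀ hdet]
  have hsm : ContMDiffAt I I.tangent ∞ (fun q ↦ (⟨q, ∑ i, (((A q).det)⁻¹ * (A q).cramer (l q) i) •
      Z i q⟩ : TangentBundle I M)) p := by
    refine ContMDiffAt.sum_section fun i _ ↦ ContMDiffAt.smul_section ?_ (hZ i p)
    refine ((ContMDiffAt.matrix_det hA).inv₀ hev.self_of_nhds.1).mul ?_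
    simp only [Matrix.cramer_apply]
    refine ContMDiffAt.matrix_det fun j k ↦ ?_
    by_cases hk : k = i
    · subst hk
      simpa [Matrix.updateCol_apply] using hl j
    · simpa [Matrix.updateCol_apply, hk] using hA j k
  refine hsm.congr_of_eventuallyEq ?_
  filter_upwards [hev] with q hq
  rw [← hq.2]

end Smooth
section Submanifold

variable [IsManifold I ∞ M] [RiemannianBundle (fun x : M ↦ TangentSpace I x)]
  [IsContMDiffRiemannianBundle I ∞ E (fun x : M ↦ TangentSpace I x)]
  [RiemannianBundle (fun x : B ↦ TangentSpace J x)]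
  [IsContMDiffRiemannianBundle J ∞ F (fun x : B ↦ TangentSpace J x)]
  [I.Boundaryless] [T2Space M] [T2Space B] {f : M → B} {p : M} {X Y Z : Π q : M, TangentSpace I q}

theorem IsSubmanifold.mdifferentiableAt (hf : IsSubmanifold I J f) (p : M) :
    MDifferentiableAt I J f p :=
  (hf.contMDiff p).mdifferentiableAt (by simp)

theorem IsSubmanifold.mdifferentiableAlongAt_mfderiv (hf : IsSubmanifold I J f)
    (hX : IsSmoothField I X) (p : M) :
    MDifferentiableAlongAt I J f (fun q ↦ mfderiv I J f q (X q)) p :=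
  (ContMDiff.along_mfderiv hf.contMDiff hX p).mdifferentiableAt (by simp)

/-- The Gauss formula: the tangential part of the derivative along a submanifold is the derivative
for the Levi-Civita connection of the induced metric. -/
theorem IsSubmanifold.tanPart_covDerivAlong (hf : IsSubmanifold I J f) (hX : IsSmoothField I X)
    (hY : IsSmoothField I Y) (p : M) :
    tanPart I J f p (covDerivAlong I J f (fun q ↦ mfderiv I J f q (Y q)) p (X p))
      = leviCivita I M Y p (X p) := by
  set A : (Π q : M, TangentSpace I q) → (Π q : M, TangentSpace I q) → TangentSpace I p :=
    fun X Y ↦ tanPart I J f p (covDerivAlong I J f (fun q ↦ mfderiv I J f q (Y q)) p (X p))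
      - leviCivita I M Y p (X p) with hA
  have hsymm {X Y} (hX : IsSmoothField I X) (hY : IsSmoothField I Y) : A X Y = A Y X := by
    have h := congrArg (tanPart I J f p) (covDerivAlong_mfderiv_sub hf.contMDiff hX hY p)
    rw [hf.tanPart_mfderiv, map_sub] at h
    simp only [hA]
    rw [sub_eq_sub_iff_sub_eq_sub]
    exact h
  have hskew {X Y Z} (hY : IsSmoothField I Y) (hZ : IsSmoothField I Z) :
      ⟪A X Y, Z p⟫ = -⟪A X Z, Y p⟫ := by
    have h1 := mvfderiv_inner_along (hf.mdifferentiableAt p) (hf.mdifferentiableAlongAt_mfderiv hY p)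
      (hf.mdifferentiableAlongAt_mfderiv hZ p) (X p)
    simp only [hf.inner_mfderiv] at h1
    have h2 := (leviCivita_isMetricCompatible (I := I) (M := M)).mvfderiv_inner_eq
      (V := fun x : M ↦ TangentSpace I x) X (hY.mdifferentiableAt p) (hZ.mdifferentiableAt p)
    have h3 := h1.symm.trans h2
    simp only [← inner_tanPart] at h3
    rw [real_inner_comm _ (mfderiv I J f p (Y p)), ← inner_tanPart] at h3
    simp only [hA, inner_sub_left]
    have h4 := real_inner_comm (Y p) (leviCivita I M Z p (X p))
    linarith
  refine sub_eq_zero.1 (ext_inner_right ℝ fun w ↦ ?_)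
  obtain ⟨Z, hZ, rfl⟩ := exists_isSmoothField_apply_eq w
  change ⟪A X Y, Z p⟫ = _
  rw [inner_zero_left]
  have h : ⟪A X Y, Z p⟫ = -⟪A X Y, Z p⟫ := by
    conv_lhs => rw [hsymm hX hY, hskew hX hZ, hsymm hY hZ, hskew hY hX, hsymm hZ hX, hskew hZ hY]
    simp
  linarith

theorem IsSubmanifold.secondFundamentalForm_comm (hf : IsSubmanifold I J f)
    (hX : IsSmoothField I X) (hY : IsSmoothField I Y) (p : M) :
    secondFundamentalForm I J f X Y p = secondFundamentalForm I J f Y X p := by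
  have h := congrArg (norPart I J f p) (covDerivAlong_mfderiv_sub hf.contMDiff hX hY p)
  rwa [norPart_mfderiv, map_sub, sub_eq_zero] at h

variable {φ : Π x : B, TangentSpace J x →L[ℝ] TangentSpace J x}

theorem IsSubmanifold.isSmoothField_tensorT (hf : IsSubmanifold I J f)
    (hφ : IsAlmostHermitian J φ) (hX : IsSmoothField I X) :
    IsSmoothField I fun q ↦ tensorT I J f φ q (X q) := by
  refine isSmoothField_of_inner fun Z hZ ↦ ?_
  simp only [tensorT_apply, inner_tanPart]
  have h : ContMDiff I J.tangent ∞
      (fun q ↦ (⟨f q, φ (f q) (mfderiv I J f q (X q))⟩ : TangentBundle J B)) :=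
    ContMDiff.clm_bundle_apply (F₁ := F) (F₂ := F) (b := f) (hφ.contMDiff.comp hf.contMDiff)
      (ContMDiff.along_mfderiv hf.contMDiff hX)
  exact ContMDiff.inner_bundle (E := fun x : B ↦ TangentSpace J x) (b := f) h
    (ContMDiff.along_mfderiv hf.contMDiff hZ)

/-- If `∇N = 0`, then `h(X, TY) = n h(X, Y)`. -/
theorem IsParallelN.secondFundamentalForm_tensorT (hN : IsParallelN I J f φ)
    (hf : IsSubmanifold I J f) (hφ : IsKahler J φ) (hX : IsSmoothField I X)
    (hY : IsSmoothField I Y) (p : M) :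
    secondFundamentalForm I J f X (fun q ↦ tensorT I J f φ q (Y q)) p
      = tensorn I J f φ p (secondFundamentalForm I J f X Y p) := by
  have hT := hf.isSmoothField_tensorT hφ.toIsAlmostHermitian hY
  have hdT := hf.mdifferentiableAlongAt_mfderiv hT p
  have hd := hφ.mdifferentiableAlongAt (hf.mdifferentiableAt p)
    (hf.mdifferentiableAlongAt_mfderiv hY p)
  have hdN : MDifferentiableAlongAt I J f
      (fun q ↦ (tensorN I J f φ q (Y q) : TangentSpace J (f q))) p := by
    have h := hd.sub (hf.mdifferentiableAt p) hdT
    simp only [hf.map_mfderiv, add_sub_cancel_left] at h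
    exact h
  have h := hφ.covDerivAlong_map (hf.mdifferentiableAt p)
    (hf.mdifferentiableAlongAt_mfderiv hY p) (X p)
  simp only [hf.map_mfderiv] at h
  rw [covDerivAlong_add (hf.mdifferentiableAt p) hdT hdN, add_apply] at h
  have h2 := congrArg (norPart I J f p) h
  rw [map_add, hf.norPart_map, hf.tanPart_covDerivAlong hX hY] at h2
  have h3 := hN X Y hX hY p
  rw [sub_eq_zero] at h3
  rw [← h3, add_comm] at h2
  exact add_left_cancel h2

theorem IsParallelN.secondFundamentalForm_tensorT_sq (hN : IsParallelN I J f φ)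
    (hf : IsSubmanifold I J f) (hφ : IsKahler J φ) (hX : IsSmoothField I X)
    (hY : IsSmoothField I Y) (p : M) :
    secondFundamentalForm I J f X (fun q ↦ (tensorT I J f φ q ^ 2) (Y q)) p
      = (tensorn I J f φ p ^ 2) (secondFundamentalForm I J f X Y p) := by
  have hT := hf.isSmoothField_tensorT hφ.toIsAlmostHermitian hY
  have h := hN.secondFundamentalForm_tensorT hf hφ hX hT p
  rw [hN.secondFundamentalForm_tensorT hf hφ hX hY p] at h
  simpa only [pow_two, Module.End.mul_apply] using h

/-- If `∇N = 0` and `T²Y = cY` at `p`, then `n² h(X, Y) = c h(X, Y)` at `p`. -/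
theorem IsParallelN.tensorn_sq_secondFundamentalForm (hN : IsParallelN I J f φ)
    (hf : IsSubmanifold I J f) (hφ : IsKahler J φ) (hX : IsSmoothField I X)
    (hY : IsSmoothField I Y) {c : ℝ} (hc : (tensorT I J f φ p ^ 2) (Y p) = c • Y p) :
    (tensorn I J f φ p ^ 2) (secondFundamentalForm I J f X Y p)
      = c • secondFundamentalForm I J f X Y p := by
  have hT2 : IsSmoothField I fun q ↦ (tensorT I J f φ q ^ 2) (Y q) := by
    simpa only [pow_two, Module.End.mul_apply] using
      hf.isSmoothField_tensorT hφ.toIsAlmostHermitian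
        (hf.isSmoothField_tensorT hφ.toIsAlmostHermitian hY)
  rw [← hN.secondFundamentalForm_tensorT_sq hf hφ hX hY, hf.secondFundamentalForm_comm hX hT2,
    hf.secondFundamentalForm_comm hX hY]
  simp only [secondFundamentalForm, hc, map_smul]

theorem IsSubmanifold.inner_shapeOperator (hf : IsSubmanifold I J f)
    {V : Π q : M, normalSpace I J f q} (hV : IsSmoothNormalField I J f V) (hZ : IsSmoothField I Z)
    (p : M) :
    ⟪shapeOperator I J f V X p, Z p⟫ = ⟪V p, secondFundamentalForm I J f X Z p⟫ := by
  have hVd : MDifferentiableAlongAt I J f (fun q ↦ (V q : TangentSpace J (f q))) p :=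
    (hV p).mdifferentiableAt (by simp)
  have h := mvfderiv_inner_along (hf.mdifferentiableAt p) hVd
    (hf.mdifferentiableAlongAt_mfderiv hZ p) (X p)
  have h0 : (fun q ↦ ⟪(V q : TangentSpace J (f q)), mfderiv I J f q (Z q)⟫) = fun _ ↦ (0 : ℝ) := by
    ext q
    rw [real_inner_comm, inner_mfderiv_normal]
  have h1 : mvfderiv I (fun _ : M ↦ (0 : ℝ)) p = 0 := mvfderiv_const 0
  rw [h0, h1, zero_apply] at h
  rw [shapeOperator, inner_neg_left, inner_tanPart, secondFundamentalForm, real_inner_comm _ (V p),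
    inner_norPart, real_inner_comm (V p : TangentSpace J (f p))]
  linarith

/-- If `∇N = 0` and `T²X = cX` at `p`, then `T² A_V X = c A_V X` at `p`. -/
theorem IsParallelN.tensorT_sq_shapeOperator (hN : IsParallelN I J f φ)
    (hf : IsSubmanifold I J f) (hφ : IsKahler J φ) {V : Π q : M, normalSpace I J f q}
    (hV : IsSmoothNormalField I J f V) (hX : IsSmoothField I X) {c : ℝ}
    (hc : (tensorT I J f φ p ^ 2) (X p) = c • X p) :
    (tensorT I J f φ p ^ 2) (shapeOperator I J f V X p) = c • shapeOperator I J f V X p := by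
  refine ext_inner_right ℝ fun w ↦ ?_
  obtain ⟨Z, hZ, rfl⟩ := exists_isSmoothField_apply_eq w
  have hT2 : IsSmoothField I fun q ↦ (tensorT I J f φ q ^ 2) (Z q) := by
    simpa only [pow_two, Module.End.mul_apply] using
      hf.isSmoothField_tensorT hφ.toIsAlmostHermitian
        (hf.isSmoothField_tensorT hφ.toIsAlmostHermitian hZ)
  have h1 : ⟪(tensorT I J f φ p ^ 2) (shapeOperator I J f V X p), Z p⟫
      = ⟪shapeOperator I J f V X p, (tensorT I J f φ p ^ 2) (Z p)⟫ := by
    simp only [pow_two, Module.End.mul_apply]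
    rw [inner_tensorT_left hφ.toIsAlmostHermitian, inner_tensorT_left hφ.toIsAlmostHermitian,
      neg_neg]
  rw [h1, hf.inner_shapeOperator hV hT2, hN.secondFundamentalForm_tensorT_sq hf hφ hX hZ,
    hf.secondFundamentalForm_comm hX hZ, hN.tensorn_sq_secondFundamentalForm hf hφ hZ hX hc,
    hf.secondFundamentalForm_comm hZ hX, real_inner_smul_left, hf.inner_shapeOperator hV hZ]
  exact real_inner_smul_right (V p) (secondFundamentalForm I J f X Z p) c

end Submanifold
section Slant

variable [IsManifold I ∞ M] [RiemannianBundle (fun x : M ↦ TangentSpace I x)]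
  [RiemannianBundle (fun x : B ↦ TangentSpace J x)] {f : M → B} {p : M}
  {φ : Π x : B, TangentSpace J x →L[ℝ] TangentSpace J x}
  {k : ℕ} {D : Fin (k + 1) → Π p : M, Submodule ℝ (TangentSpace I p)} {θ : Fin (k + 1) → M → ℝ}

theorem IsSubmanifold.tensorT_tensorT (hf : IsSubmanifold I J f) (hφ : IsAlmostHermitian J φ)
    (u : TangentSpace I p) :
    tensorT I J f φ p (tensorT I J f φ p u)
      + tanPart I J f p (φ (f p) (tensorN I J f φ p u)) = -u := by
  have h := congrArg (fun w ↦ tanPart I J f p (φ (f p) w)) (hf.map_mfderiv (φ := φ) u)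
  simp only [hφ.map_map, map_add, map_neg, hf.tanPart_mfderiv] at h
  exact h.symm

theorem IsSubmanifold.tensorn_tensorN (hf : IsSubmanifold I J f) (hφ : IsAlmostHermitian J φ)
    (u : TangentSpace I p) :
    tensorn I J f φ p (tensorN I J f φ p u) = -tensorN I J f φ p (tensorT I J f φ p u) := by
  have h := congrArg (fun w ↦ norPart I J f p (φ (f p) w)) (hf.map_mfderiv (φ := φ) u)
  simp only [hφ.map_map, map_add, map_neg, norPart_mfderiv] at h
  rw [eq_neg_iff_add_eq_zero, add_comm, ← neg_eq_zero.2 (rfl : (0 : normalSpace I J f p) = 0)]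
  exact h.symm

theorem IsSubmanifold.tensorn_sq_tensorN (hf : IsSubmanifold I J f) (hφ : IsAlmostHermitian J φ)
    (u : TangentSpace I p) :
    (tensorn I J f φ p ^ 2) (tensorN I J f φ p u)
      = tensorN I J f φ p ((tensorT I J f φ p ^ 2) u) := by
  simp only [pow_two, Module.End.mul_apply]
  rw [hf.tensorn_tensorN hφ, map_neg, hf.tensorn_tensorN hφ, neg_neg]

theorem inner_tensorN (hφ : IsAlmostHermitian J φ) (u : TangentSpace I p)
    (V : normalSpace I J f p) :
    ⟪tensorN I J f φ p u, V⟫ = -⟪u, tanPart I J f p (φ (f p) V)⟫ := by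
  rw [tensorN_apply, inner_norPart, hφ.inner_map_left, real_inner_comm _ u, inner_tanPart,
    real_inner_comm]

/-- A normal vector orthogonal to the range of `N` is an eigenvector of `n²` for `-1`. -/
theorem IsSubmanifold.tensorn_sq_eq_neg_of_inner_tensorN (hf : IsSubmanifold I J f)
    (hφ : IsAlmostHermitian J φ) {V : normalSpace I J f p}
    (hV : ∀ u, ⟪tensorN I J f φ p u, V⟫ = 0) : (tensorn I J f φ p ^ 2) V = -V := by
  have ht : tanPart I J f p (φ (f p) V) = 0 := by
    refine ext_inner_left ℝ fun u ↦ ?_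
    rw [inner_zero_right, ← neg_eq_zero, ← inner_tensorN hφ, hV]
  have h := mfderiv_tanPart_add_norPart I J hf p (φ (f p) V)
  rw [ht, map_zero, zero_add, ← tensorn_apply] at h
  simp only [pow_two, Module.End.mul_apply]
  rw [tensorn_apply, h, hφ.map_map, map_neg, norPart_normal]

/-- An eigenvector of `n²` for `-1` is orthogonal to the range of `N`. -/
theorem IsSubmanifold.inner_tensorN_eq_zero (hf : IsSubmanifold I J f)
    (hφ : IsAlmostHermitian J φ) {V : normalSpace I J f p} (hV : (tensorn I J f φ p ^ 2) V = -V)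
    (u : TangentSpace I p) : ⟪tensorN I J f φ p u, V⟫ = 0 := by
  have h1 : ⟪tensorn I J f φ p V, tensorn I J f φ p V⟫ = ⟪V, V⟫ := by
    simp only [pow_two, Module.End.mul_apply] at hV
    rw [inner_tensorn_left hφ, hV, inner_neg_right, neg_neg]
  have h := mfderiv_tanPart_add_norPart I J hf p (φ (f p) V)
  rw [← tensorn_apply] at h
  have h2 := hφ.inner_map_map (f p) V V
  rw [← h, inner_add_left, inner_add_right, inner_add_right, inner_mfderiv_normal,
    real_inner_comm (mfderiv I J f p _) (tensorn I J f φ p V : TangentSpace J (f p)),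
    inner_mfderiv_normal, hf.inner_mfderiv] at h2
  have h3 : ⟪tanPart I J f p (φ (f p) V), tanPart I J f p (φ (f p) V)⟫ = 0 := by
    simp only [Submodule.coe_inner] at h1
    linarith
  rw [inner_tensorN hφ, inner_self_eq_zero.1 h3, inner_zero_right, neg_zero]

theorem IsPointwiseSlant.inner_tensorT_self (h : IsPointwiseSlant I J f φ k D θ)
    (hφ : IsAlmostHermitian J φ) {i : Fin (k + 1)} (hi : i ≠ 0) {u : TangentSpace I p}
    (hu : u ∈ D i p) :
    ⟪tensorT I J f φ p u, tensorT I J f φ p u⟫ = Real.cos (θ i p) ^ 2 * ⟪u, u⟫ := by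
  rcases eq_or_ne u 0 with rfl | hu0
  · simp
  have hf := h.toIsSubmanifold
  have hn (v : TangentSpace I p) : ‖mfderiv I J f p v‖ = ‖v‖ := by
    rw [norm_eq_sqrt_real_inner, hf.inner_mfderiv, ← norm_eq_sqrt_real_inner]
  have hnφ (w : TangentSpace J (f p)) : ‖φ (f p) w‖ = ‖w‖ := by
    rw [norm_eq_sqrt_real_inner, hφ.inner_map_map, ← norm_eq_sqrt_real_inner]
  have hproj : ((D i p).map (mfderiv I J f p).toLinearMap).starProjection
      (φ (f p) (mfderiv I J f p u)) = mfderiv I J f p (tensorT I J f φ p u) := by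
    refine Submodule.eq_starProjection_of_mem_orthogonal
      ⟨_, h.tensorT_mem i hi p u hu, rfl⟩ ?_
    rw [hf.map_mfderiv, add_sub_cancel_left]
    rintro _ ⟨v, -, rfl⟩
    exact inner_mfderiv_normal v _
  have hθ := h.slant i hi p u hu hu0
  rw [angleToSubspace, hproj] at hθ
  rw [← hθ, InnerProductGeometry.cos_angle, hnφ, hn, hn, ← inner_tanPart, ← tensorT_apply,
    real_inner_self_eq_norm_sq, real_inner_self_eq_norm_sq]
  have hu' : ‖u‖ ≠ 0 := norm_ne_zero_iff.2 hu0
  rcases eq_or_ne (‖tensorT I J f φ p u‖) 0 with h0 | h0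
  · simp [h0]
  · field_simp

theorem IsPointwiseSlant.tensorT_sq (h : IsPointwiseSlant I J f φ k D θ)
    (hφ : IsAlmostHermitian J φ) (i : Fin (k + 1)) {u : TangentSpace I p} (hu : u ∈ D i p) :
    (tensorT I J f φ p ^ 2) u = (-Real.cos (θ i p) ^ 2) • u := by
  have hf := h.toIsSubmanifold
  simp only [pow_two (tensorT I J f φ p), Module.End.mul_apply]
  rcases eq_or_ne i 0 with rfl | hi
  · obtain ⟨w, -, hw⟩ := h.invariant p u hu
    have hw' : mfderiv I J f p w = φ (f p) (mfderiv I J f p u) := hw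
    rw [h.angle_zero, Real.cos_zero, tensorT_apply u, ← hw', hf.tanPart_mfderiv, tensorT_apply, hw',
      hφ.map_map, map_neg, hf.tanPart_mfderiv]
    simp
  set c := Real.cos (θ i p) ^ 2
  have hq (v : TangentSpace I p) (hv : v ∈ D i p) := h.inner_tensorT_self hφ hi hv
  obtain ⟨s, hs⟩ : ∃ s, s = tensorT I J f φ p (tensorT I J f φ p u) + c • u := ⟨_, rfl⟩
  have hsD : s ∈ D i p := hs ▸ add_mem (h.tensorT_mem i hi p _ (h.tensorT_mem i hi p u hu))
    ((D i p).smul_mem c hu)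
  have h1 := hq _ (add_mem hu hsD)
  simp only [map_add, inner_add_left, inner_add_right, hq u hu, hq s hsD] at h1
  rw [real_inner_comm (tensorT I J f φ p u) (tensorT I J f φ p s), real_inner_comm u s] at h1
  have h2 : ⟪s, s⟫ = 0 := by
    have h3 (t : TangentSpace I p) :
        ⟪s, t⟫ = ⟪tensorT I J f φ p (tensorT I J f φ p u), t⟫ + c * ⟪u, t⟫ := by
      rw [hs, inner_add_left, real_inner_smul_left]
    specialize h3 s
    rw [inner_tensorT_left hφ] at h3
    linarith
  rw [neg_smul, eq_neg_iff_add_eq_zero, ← hs]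
  exact inner_self_eq_zero.1 h2

theorem IsPointwiseSlant.cos_sq_ne_one (h : IsPointwiseSlant I J f φ k D θ) {i : Fin (k + 1)}
    (hi : i ≠ 0) (p : M) : Real.cos (θ i p) ^ 2 ≠ 1 := by
  obtain ⟨h0, h1⟩ := h.angle_mem i hi p
  have hs := Real.sin_pos_of_pos_of_lt_pi h0 (by linarith [Real.pi_pos])
  nlinarith [Real.sin_sq_add_cos_sq (θ i p)]

theorem IsPointwiseSlant.tensorT_sq_of_tensorN_eq_zero (h : IsPointwiseSlant I J f φ k D θ)
    (hφ : IsAlmostHermitian J φ) {u : TangentSpace I p} (hu : tensorN I J f φ p u = 0) :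
    (tensorT I J f φ p ^ 2) u = -u := by
  have h1 := h.toIsSubmanifold.tensorT_tensorT hφ u
  simpa [hu, pow_two] using h1

theorem IsPointwiseSlant.ker_tensorN (h : IsPointwiseSlant I J f φ k D θ)
    (hφ : IsAlmostHermitian J φ) (p : M) : LinearMap.ker (tensorN I J f φ p) = D 0 p := by
  refine le_antisymm (fun u hu ↦ ?_) fun u hu ↦ ?_
  · have hT := h.tensorT_sq_of_tensorN_eq_zero hφ hu
    have horth (j) (hj : j ≠ 0) (v : TangentSpace I p) (hv : v ∈ D j p) : ⟪v, u⟫ = 0 := by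
      have h1 : ⟪(tensorT I J f φ p ^ 2) v, u⟫ = ⟪v, (tensorT I J f φ p ^ 2) u⟫ := by
        simp only [pow_two, Module.End.mul_apply]
        rw [inner_tensorT_left hφ, inner_tensorT_left hφ, neg_neg]
      rw [hT, h.tensorT_sq hφ j hv, real_inner_smul_left, inner_neg_right] at h1
      have h2 : (1 - Real.cos (θ j p) ^ 2) * ⟪v, u⟫ = 0 := by linarith
      exact (mul_eq_zero.1 h2).resolve_left (sub_ne_zero.2 (h.cos_sq_ne_one hj p).symm)
    set w := u - (D 0 p).starProjection u with hw
    have hle : ⨆ j, D j p ≤ (ℝ ∙ w)ᗮ := by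
      refine iSup_le fun j v hv ↦ ?_
      rw [Submodule.mem_orthogonal_singleton_iff_inner_left, hw]
      rcases eq_or_ne j 0 with rfl | hj
      · exact Submodule.sub_starProjection_mem_orthogonal u v hv
      · rw [inner_sub_right, horth j hj v hv,
          h.orthogonal j 0 hj p v hv _ (Submodule.starProjection_apply_mem _ _), sub_zero]
    rw [h.iSup_eq_top p] at hle
    have h0 : w = 0 := by
      have := hle (Submodule.mem_top (x := w))
      rw [Submodule.mem_orthogonal_singleton_iff_inner_left] at this
      exact inner_self_eq_zero.1 this
    rw [sub_eq_zero.1 h0]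
    exact Submodule.starProjection_apply_mem _ _
  · obtain ⟨w, -, hw⟩ := h.invariant p u hu
    have hw' : mfderiv I J f p w = φ (f p) (mfderiv I J f p u) := hw
    rw [LinearMap.mem_ker, tensorN_apply, ← hw', norPart_mfderiv]

theorem IsSubmanifold.finrank_normalSpace (hf : IsSubmanifold I J f) (p : M) :
    finrank ℝ E + finrank ℝ (normalSpace I J f p) = finrank ℝ F := by
  have h := Submodule.finrank_add_finrank_orthogonal
    (LinearMap.range (mfderiv I J f p).toLinearMap)
  rw [LinearMap.finrank_range_of_inj (hf.mfderiv_injective p)] at h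
  exact h

/-- If `-1` is an eigenvalue of `n²` at some point, then it is one at every point. -/
theorem IsPointwiseSlant.hasEigenvalue_neg_one (h : IsPointwiseSlant I J f φ k D θ)
    (hφ : IsAlmostHermitian J φ) {p₀ : M} {V : normalSpace I J f p₀} (hV0 : V ≠ 0)
    (hV : (tensorn I J f φ p₀ ^ 2) V = -V) (p : M) :
    Module.End.HasEigenvalue (tensorn I J f φ p ^ 2) (-1) := by
  have hf := h.toIsSubmanifold
  have hne : LinearMap.range (tensorN I J f φ p₀) ≠ ⊤ := by
    intro htop
    obtain ⟨u, hu⟩ := LinearMap.range_eq_top.1 htop V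
    have h0 := hf.inner_tensorN_eq_zero hφ hV u
    rw [hu] at h0
    exact hV0 (inner_self_eq_zero.1 h0)
  obtain ⟨r, hr, -⟩ := h.regular 0
  have hrank (q : M) : finrank ℝ (LinearMap.range (tensorN I J f φ q)) + r = finrank ℝ E := by
    have h1 := LinearMap.finrank_range_add_finrank_ker (tensorN I J f φ q)
    rw [h.ker_tensorN hφ q, hr q] at h1
    exact h1
  have hlt := Submodule.finrank_lt hne
  have hlt' : finrank ℝ (LinearMap.range (tensorN I J f φ p))
      < finrank ℝ (normalSpace I J f p) := by
    have h1 := hrank p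
    have h2 := hrank p₀
    have h3 := hf.finrank_normalSpace p
    have h4 := hf.finrank_normalSpace p₀
    omega
  have hbot : (LinearMap.range (tensorN I J f φ p))ᗮ ≠ ⊥ := by
    intro hb
    have h1 := Submodule.finrank_add_finrank_orthogonal (LinearMap.range (tensorN I J f φ p))
    rw [hb, finrank_bot] at h1
    omega
  obtain ⟨W, hW, hW0⟩ := (Submodule.ne_bot_iff _).1 hbot
  refine Module.End.hasEigenvalue_of_hasEigenvector (x := W)
    ⟨Module.End.mem_eigenspace_iff.2 ?_, hW0⟩
  rw [hf.tensorn_sq_eq_neg_of_inner_tensorN hφ fun u ↦ hW _ ⟨u, rfl⟩, neg_one_smul]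

theorem IsPointwiseSlant.hasEigenvalue_tensorT_sq (h : IsPointwiseSlant I J f φ k D θ)
    (hφ : IsAlmostHermitian J φ) {i : Fin (k + 1)} (hD : D i p ≠ ⊥) :
    Module.End.HasEigenvalue (tensorT I J f φ p ^ 2) (-Real.cos (θ i p) ^ 2) := by
  obtain ⟨u, hu, hu0⟩ := (Submodule.ne_bot_iff _).1 hD
  exact Module.End.hasEigenvalue_of_hasEigenvector
    ⟨Module.End.mem_eigenspace_iff.2 (h.tensorT_sq hφ i hu), hu0⟩

theorem IsPointwiseSlant.hasEigenvalue_tensorn_sq (h : IsPointwiseSlant I J f φ k D θ)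
    (hφ : IsAlmostHermitian J φ) {i : Fin (k + 1)} (hi : i ≠ 0) (p : M) :
    Module.End.HasEigenvalue (tensorn I J f φ p ^ 2) (-Real.cos (θ i p) ^ 2) := by
  have hf := h.toIsSubmanifold
  obtain ⟨u, hu, hu0⟩ := (Submodule.ne_bot_iff _).1 (h.nontrivial i hi p)
  refine Module.End.hasEigenvalue_of_hasEigenvector (x := tensorN I J f φ p u)
    ⟨Module.End.mem_eigenspace_iff.2 ?_, fun h0 ↦ ?_⟩
  · rw [hf.tensorn_sq_tensorN hφ, h.tensorT_sq hφ i hu, map_smul]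
  · have h1 : u ∈ D 0 p := by
      rw [← h.ker_tensorN hφ p]
      exact h0
    exact hu0 (inner_self_eq_zero.1 (h.orthogonal i 0 hi p u hu u h1))

end Slant

end SlantGeometry

end

theorem theorem3p6
    -- the ambient manifold `B`, a Kähler manifold
    {F : Type*} [NormedAddCommGroup F] [NormedSpace ℝ F] [FiniteDimensional ℝ F]
    {B : Type*} [TopologicalSpace B] [T2Space B] [ChartedSpace F B] [IsManifold 𝓘(ℝ, F) ∞ B]
    [RiemannianBundle (fun x : B ↦ TangentSpace 𝓘(ℝ, F) x)]
    [IsContMDiffRiemannianBundle 𝓘(ℝ, F) ∞ F (fun x : B ↦ TangentSpace 𝓘(ℝ, F) x)]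
    (φ : Π x : B, TangentSpace 𝓘(ℝ, F) x →L[ℝ] TangentSpace 𝓘(ℝ, F) x)
    (hφ : IsKahler 𝓘(ℝ, F) φ)
    -- the submanifold `M`, with the metric induced by `f`
    {E : Type*} [NormedAddCommGroup E] [NormedSpace ℝ E] [FiniteDimensional ℝ E]
    {M : Type*} [TopologicalSpace M] [T2Space M] [ChartedSpace E M] [IsManifold 𝓘(ℝ, E) ∞ M]
    [RiemannianBundle (fun x : M ↦ TangentSpace 𝓘(ℝ, E) x)]
    [IsContMDiffRiemannianBundle 𝓘(ℝ, E) ∞ E (fun x : M ↦ TangentSpace 𝓘(ℝ, E) x)]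
    (f : M → B) (k : ℕ) (hk : 1 ≤ k)
    (D : Fin (k + 1) → Π p : M, Submodule ℝ (TangentSpace 𝓘(ℝ, E) p))
    (θ : Fin (k + 1) → M → ℝ)
    (hM : IsPointwiseSlant 𝓘(ℝ, E) 𝓘(ℝ, F) f φ k D θ)
    (hN : IsParallelN 𝓘(ℝ, E) 𝓘(ℝ, F) f φ) :
    (∀ i, i ≠ 0 → ∀ X Y : Π p : M, TangentSpace 𝓘(ℝ, E) p,
      IsSmoothSection 𝓘(ℝ, E) (D 0) X → IsSmoothSection 𝓘(ℝ, E) (D i) Y →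
        ∀ p, secondFundamentalForm 𝓘(ℝ, E) 𝓘(ℝ, F) f X Y p = 0) ∧
    (∀ i,
      (∀ X Y : Π p : M, TangentSpace 𝓘(ℝ, E) p,
        IsSmoothSection 𝓘(ℝ, E) (D i) X → IsSmoothSection 𝓘(ℝ, E) (D i) Y →
          ∀ p, secondFundamentalForm 𝓘(ℝ, E) 𝓘(ℝ, F) f X Y p = 0) ∨
      ((∀ p, Module.End.HasEigenvalue (tensorn 𝓘(ℝ, E) 𝓘(ℝ, F) f φ p ^ 2)
          (-Real.cos (θ i p) ^ 2)) ∧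
        ∀ X Y : Π p : M, TangentSpace 𝓘(ℝ, E) p,
          IsSmoothSection 𝓘(ℝ, E) (D i) X → IsSmoothSection 𝓘(ℝ, E) (D i) Y →
            ∀ p, secondFundamentalForm 𝓘(ℝ, E) 𝓘(ℝ, F) f X Y p ≠ 0 →
              Module.End.HasEigenvector (tensorn 𝓘(ℝ, E) 𝓘(ℝ, F) f φ p ^ 2)
                (-Real.cos (θ i p) ^ 2) (secondFundamentalForm 𝓘(ℝ, E) 𝓘(ℝ, F) f X Y p))) ∧
    (∀ i,
      (∀ X Y : Π p : M, TangentSpace 𝓘(ℝ, E) p,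
        IsSmoothSection 𝓘(ℝ, E) (D i) X → IsSmoothField 𝓘(ℝ, E) Y →
          ∀ p, secondFundamentalForm 𝓘(ℝ, E) 𝓘(ℝ, F) f X Y p = 0) ∨
      ((∀ p, Module.End.HasEigenvalue (tensorT 𝓘(ℝ, E) 𝓘(ℝ, F) f φ p ^ 2)
          (-Real.cos (θ i p) ^ 2)) ∧
        ∀ (X : Π p : M, TangentSpace 𝓘(ℝ, E) p)
          (V : Π p : M, normalSpace 𝓘(ℝ, E) 𝓘(ℝ, F) f p),
          IsSmoothSection 𝓘(ℝ, E) (D i) X → IsSmoothNormalField 𝓘(ℝ, E) 𝓘(ℝ, F) f V →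
            ∀ p, shapeOperator 𝓘(ℝ, E) 𝓘(ℝ, F) f V X p ≠ 0 →
              Module.End.HasEigenvector (tensorT 𝓘(ℝ, E) 𝓘(ℝ, F) f φ p ^ 2)
                (-Real.cos (θ i p) ^ 2) (shapeOperator 𝓘(ℝ, E) 𝓘(ℝ, F) f V X p))) := by
  have hf := hM.toIsSubmanifold
  have hh := hφ.toIsAlmostHermitian
  refine ⟨fun i hi X Y hX hY p ↦ ?_, fun i ↦ ?_, fun i ↦ ?_⟩
  · have h1 := hN.tensorn_sq_secondFundamentalForm hf hφ hX.1 hY.1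
      (hM.tensorT_sq hh i (hY.2 p))
    have h2 := hN.tensorn_sq_secondFundamentalForm hf hφ hY.1 hX.1
      (hM.tensorT_sq hh 0 (hX.2 p))
    rw [hf.secondFundamentalForm_comm hY.1 hX.1, h1, hM.angle_zero, Real.cos_zero,
      ← sub_eq_zero, ← sub_smul, smul_eq_zero] at h2
    refine h2.resolve_left fun h3 ↦ hM.cos_sq_ne_one hi p ?_
    linarith
  · refine or_iff_not_imp_left.2 fun hne ↦ ⟨fun p ↦ ?_, fun X Y hX hY p h0 ↦
      ⟨Module.End.mem_eigenspace_iff.2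
        (hN.tensorn_sq_secondFundamentalForm hf hφ hX.1 hY.1 (hM.tensorT_sq hh i (hY.2 p))), h0⟩⟩
    rcases eq_or_ne i 0 with rfl | hi
    · push Not at hne
      obtain ⟨X, Y, hX, hY, p₀, h0⟩ := hne
      have h1 := hN.tensorn_sq_secondFundamentalForm hf hφ hX.1 hY.1
        (hM.tensorT_sq hh 0 (hY.2 p₀))
      rw [hM.angle_zero, Real.cos_zero, one_pow, neg_one_smul] at h1
      rw [hM.angle_zero, Real.cos_zero, one_pow]
      exact hM.hasEigenvalue_neg_one hh h0 h1 p
    · exact hM.hasEigenvalue_tensorn_sq hh hi p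
  · obtain ⟨r, hr, -⟩ := hM.regular i
    rcases eq_or_ne r 0 with rfl | hr0
    · refine .inl fun X Y hX _ p ↦ ?_
      have h0 : X p = 0 := by
        have h1 := hX.2 p
        rwa [Submodule.finrank_eq_zero.1 (hr p), Submodule.mem_bot] at h1
      rw [secondFundamentalForm, h0, map_zero, map_zero]
    · refine .inr ⟨fun p ↦ hM.hasEigenvalue_tensorT_sq hh fun hb ↦ hr0 ?_,
        fun X V hX hV p h0 ↦ ⟨Module.End.mem_eigenspace_iff.2
          (hN.tensorT_sq_shapeOperator hf hφ hV hX.1 (hM.tensorT_sq hh i (hX.2 p))), h0⟩⟩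
      rw [← hr p, hb, finrank_bot]
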